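/- For a graph $G$ and an integer $t\ge 0$, let the $t$-dependence number $\alpha^t(G)$ be the maximum size of a vertex subset inducing a subgraph of maximum degree at most $t$. Let $G_{n,p}$ be the random graph on $n$ labelled vertices in which each pair is an edge independently with probability $p$. For $0<p<1$ put $$\Lambda^*(x)=x\ln\frac{x}{p}+(1-x)\ln\frac{1-x}{1-p}\quad(0\le x\le 1,\ 0\ln 0:=0),$$ and for $\tau\ge 0$ let $\kappa_p(\tau)$ be the unique $\kappa>\tau/p$ with $\frac{\kappa}{2}\Lambda^*\!\left(\frac{\tau}{\kappa}\right)=1$. Fix $0<p<1$, $\tau\ge 0$ and $\varepsilon>0$. There is a constant $c>0$, depending only on $p,\tau,\varepsilon$, such that for every sequence of non-negative integers $t=t(n)$ and every real sequence $k=k(n)$ with $$\frac{t(n)}{\ln n}\to\tau\qquad\text{and}\qquad \frac{k(n)}{\ln n}\to\kappa_p(\tau)-\varepsilon\qquad(n\to\infty),$$ we have, for all sufficiently large $n$, $$\Pr\big(\alpha^{t(n)}(G_{n,p})<k(n)\big)\le \exp\!\left(-c\,\frac{n^2}{(\ln n)^5}\right).$$ -/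

import Mathlib

open Filter Topology MeasureTheory

section Dependence

open Classical in
/-- A vertex subset `S` is `t`-dependent in `G` if it induces a subgraph of maximum degree
at most `t`. -/
def IsDependentSet {V : Type*} (G : SimpleGraph V) (t : ℕ) (S : Finset V) : Prop :=
  (G.induce (S : Set V)).maxDegree ≤ t

open Classical in
/-- The `t`-dependence number of `G`: the maximum size of a `t`-dependent set.  The empty set
is always `t`-dependent, so this is a maximum over a nonempty finite family. -/
noncomputable def dependenceNumber {V : Type*} [Fintype V] (G : SimpleGraph V) (t : ℕ) : ℕ :=
  (Finset.univ.filter fun S : Finset V => IsDependentSet G t S).sup Finset.card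

end Dependence

section Rate

/-- The function `Λ*(x) = x ln (x / p) + (1 - x) ln ((1 - x) / (1 - p))` on `[0, 1]`, with the
values `Λ*(0) = ln (1 / (1 - p))` and `Λ*(1) = ln (1 / p)` at the end points (these come out
right because `0 * ln 0 = 0`).  It is only ever evaluated at points of `[0, 1]`. -/
noncomputable def rateFn (p x : ℝ) : ℝ :=
  x * Real.log (x / p) + (1 - x) * Real.log ((1 - x) / (1 - p))

/-- `κ_p(τ)`: the unique `κ > τ / p` with `(κ / 2) Λ*(τ / κ) = 1`.  The set below is a singleton
for `0 < p < 1` and `0 ≤ τ`, see `kappa_spec`. -/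
noncomputable def kappa (p τ : ℝ) : ℝ :=
  sInf {κ : ℝ | τ / p < κ ∧ κ / 2 * rateFn p (τ / κ) = 1}

theorem continuous_rateFn {p : ℝ} (hp0 : 0 < p) (hp1 : p < 1) : Continuous (rateFn p) := by
  have hq : 1 - p ≠ 0 := by linarith
  have h : rateFn p = fun x => p * ((x / p) * Real.log (x / p)) +
      (1 - p) * (((1 - x) / (1 - p)) * Real.log ((1 - x) / (1 - p))) := by
    funext x
    unfold rateFn
    field_simp
  rw [h]
  have h1 : Continuous fun x : ℝ => (x / p) * Real.log (x / p) :=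
    Real.continuous_mul_log.comp (continuous_id.div_const p)
  have h2 : Continuous fun x : ℝ => ((1 - x) / (1 - p)) * Real.log ((1 - x) / (1 - p)) :=
    Real.continuous_mul_log.comp ((continuous_const.sub continuous_id).div_const (1 - p))
  exact (h1.const_mul p).add (h2.const_mul (1 - p))

theorem rateFn_zero_pos {p : ℝ} (hp0 : 0 < p) (hp1 : p < 1) : 0 < rateFn p 0 := by
  have h : 1 < 1 / (1 - p) := by
    rw [lt_div_iff₀ (by linarith)]; linarith
  simpa [rateFn] using Real.log_pos h

theorem continuousOn_half_mul_rateFn {p τ : ℝ} (hp0 : 0 < p) (hp1 : p < 1) (hτ : 0 ≤ τ) :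
    ContinuousOn (fun κ : ℝ => κ / 2 * rateFn p (τ / κ)) (Set.Ici (τ / p)) := by
  rcases hτ.eq_or_lt with rfl | hτ
  · simp only [zero_div]
    fun_prop
  · have hpos : 0 < τ / p := div_pos hτ hp0
    refine (continuousOn_id.div_const 2).mul
      ((continuous_rateFn hp0 hp1).comp_continuousOn ?_)
    exact continuousOn_const.div continuousOn_id fun x hx => (hpos.trans_le hx).ne'

theorem strictMonoOn_half_mul_rateFn {p τ : ℝ} (hp0 : 0 < p) (hp1 : p < 1) (hτ : 0 ≤ τ) :
    StrictMonoOn (fun κ : ℝ => κ / 2 * rateFn p (τ / κ)) (Set.Ici (τ / p)) := by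
  rcases hτ.eq_or_lt with rfl | hτ
  · intro x _ y _ hxy
    simp only [zero_div]
    have := rateFn_zero_pos hp0 hp1
    nlinarith
  · refine strictMonoOn_of_deriv_pos (convex_Ici _)
      (continuousOn_half_mul_rateFn hp0 hp1 hτ.le) ?_
    intro κ hκ
    rw [interior_Ici, Set.mem_Ioi] at hκ
    have hκ0 : 0 < κ := (div_pos hτ hp0).trans hκ
    have hq : 0 < 1 - p := by linarith
    have hxp : τ / κ < p := by
      rw [div_lt_iff₀ hp0] at hκ
      rw [div_lt_iff₀ hκ0]; linarith
    have hx0 : 0 < τ / κ := div_pos hτ hκ0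
    have hx : HasDerivAt (fun y : ℝ => τ / y) (-(τ / κ ^ 2)) κ := by
      have := (hasDerivAt_inv hκ0.ne').const_mul τ
      simpa [div_eq_mul_inv] using this
    have h1 : HasDerivAt (fun x : ℝ => x * Real.log (x / p))
        (1 * Real.log (τ / κ / p) + τ / κ * (1 / p / (τ / κ / p))) (τ / κ) :=
      (hasDerivAt_id _).mul (((hasDerivAt_id _).div_const p).log (div_pos hx0 hp0).ne')
    have h2 : HasDerivAt (fun x : ℝ => (1 - x) * Real.log ((1 - x) / (1 - p)))
        (-1 * Real.log ((1 - τ / κ) / (1 - p)) +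
          (1 - τ / κ) * (-1 / (1 - p) / ((1 - τ / κ) / (1 - p)))) (τ / κ) :=
      ((hasDerivAt_id _).const_sub 1).mul
        ((((hasDerivAt_id _).const_sub 1).div_const (1 - p)).log
          (div_pos (show (0 : ℝ) < 1 - τ / κ by linarith) hq).ne')
    have h3 := (((hasDerivAt_id κ).div_const 2).mul ((h1.add h2).comp κ hx)).deriv
    have h4 : deriv (fun κ : ℝ => κ / 2 * rateFn p (τ / κ)) κ =
        1 / 2 * Real.log ((1 - τ / κ) / (1 - p)) := by
      refine Eq.trans h3 ?_
      have hκτ : κ - τ ≠ 0 := by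
        have : τ < p * κ := (div_lt_iff₀ hκ0).1 hxp
        nlinarith
      have hd : (1 - τ / κ) ≠ 0 := by linarith
      have e1 : τ / κ * (1 / p / (τ / κ / p)) = 1 := by field_simp
      have e2 : (1 - τ / κ) * (-1 / (1 - p) / ((1 - τ / κ) / (1 - p))) = -1 := by
        field_simp
      rw [e1, e2]
      simp only [id, Pi.add_apply, Function.comp]
      field_simp
      ring
    rw [h4]
    have : 1 < (1 - τ / κ) / (1 - p) := by
      rw [lt_div_iff₀ hq]; linarith
    have := Real.log_pos this
    linarith

theorem exists_kappa {p τ : ℝ} (hp0 : 0 < p) (hp1 : p < 1) (hτ : 0 ≤ τ) :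
    ∃ κ : ℝ, τ / p < κ ∧ κ / 2 * rateFn p (τ / κ) = 1 := by
  have hlow : τ / p / 2 * rateFn p (τ / (τ / p)) = 0 := by
    rcases hτ.eq_or_lt with rfl | hτ
    · simp
    · have : τ / (τ / p) = p := by field_simp
      have hq : 1 - p ≠ 0 := by linarith
      rw [this]
      simp [rateFn, hp0.ne', hq]
  have hlim : Tendsto (fun κ : ℝ => κ / 2 * rateFn p (τ / κ)) atTop atTop := by
    refine Tendsto.atTop_mul_pos (rateFn_zero_pos hp0 hp1)
      (tendsto_id.atTop_div_const (by norm_num)) ?_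
    exact ((continuous_rateFn hp0 hp1).tendsto 0).comp (tendsto_id.const_div_atTop τ)
  obtain ⟨M, hM1, hM⟩ := ((hlim.eventually_ge_atTop 1).and (eventually_ge_atTop (τ / p))).exists
  have hc := (continuousOn_half_mul_rateFn hp0 hp1 hτ).mono
    (show Set.Icc (τ / p) M ⊆ Set.Ici (τ / p) from Set.Icc_subset_Ici_self)
  obtain ⟨κ, hκ, h⟩ := intermediate_value_Icc hM hc
    (show (1 : ℝ) ∈ Set.Icc _ _ from ⟨by simp only [hlow]; norm_num, hM1⟩)
  refine ⟨κ, lt_of_le_of_ne hκ.1 ?_, h⟩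
  rintro rfl
  simp only [hlow] at h
  norm_num at h

/-- `κ_p(τ)` is well defined, and it is the threshold at which `(κ / 2) Λ*(τ / κ)` passes `1`. -/
theorem kappa_spec {p τ : ℝ} (hp0 : 0 < p) (hp1 : p < 1) (hτ : 0 ≤ τ) :
    τ / p < kappa p τ ∧ kappa p τ / 2 * rateFn p (τ / kappa p τ) = 1 ∧
      (∀ κ, τ / p < κ → κ < kappa p τ → κ / 2 * rateFn p (τ / κ) < 1) ∧
      (∀ κ, kappa p τ < κ → 1 < κ / 2 * rateFn p (τ / κ)) := by
  obtain ⟨κ₀, h0, h1⟩ := exists_kappa hp0 hp1 hτ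
  have hmono := strictMonoOn_half_mul_rateFn hp0 hp1 hτ
  have hset : {κ : ℝ | τ / p < κ ∧ κ / 2 * rateFn p (τ / κ) = 1} = {κ₀} := by
    ext κ
    refine ⟨fun h => hmono.injOn h.1.le h0.le (h.2.trans h1.symm), ?_⟩
    rintro rfl
    exact ⟨h0, h1⟩
  have hk : kappa p τ = κ₀ := by rw [kappa, hset, csInf_singleton]
  rw [hk]
  refine ⟨h0, h1, fun κ ha hb => ?_, fun κ ha => ?_⟩
  · rw [← h1]; exact hmono ha.le h0.le hb
  · rw [← h1]; exact hmono h0.le (h0.trans ha).le ha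

end Rate

/-! Fix `κ` slightly below `kappa p τ`, put `k = ⌈κ ln n⌉`, and take `θ` equal to or slightly below
`τ / κ`. A `k`-set is `⌊θ k⌋`-dependent with probability `P = exp (-(k² / 2) (Λ*(θ) + o(1)))`, so
the expected number of such sets is large because `κ / 2 * Λ*(θ) < 1`. To bound the probability that
none exists, a Janson inequality is applied to these events. They are down-sets in the edges, and
two of them are independent when the vertex sets share at most one point.

The inequality in `janson` gives `exp (-1 / (2 Q))`, where `Q` bounds the ratio of the sum of `P(B_S
∩ B_S')` over dependent pairs (diagonal included) to the square of the mean. A fixed `S` has at most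
`(k² / n) ^ l * C(n, k)` sets `S'` with `|S ∩ S'| = l`. It therefore suffices that `(k² / n) ^ l *
P(B_S ∩ B_S') / P²` be at most `M = k⁴ / ((1 - p) n²)` for each `l ≥ 2`. Summing over at most `k`
values of `l` gives `Q = k M`, hence the exponent of order `n² / k⁵`.

For `l ≤ δ k`, deleting the shared edges decouples the two events at a cost of `(1 - p) ^ C(l, 2)`
(`prob_degreesLE_inter_mul_pow_le`), and `l = 2` is the critical overlap. For larger `l`, only the
degrees of the `k - l` new vertices are kept (`prob_degreesLE_inter_le`). Chernoff's bound gives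
each such vertex a factor of about `exp (-(k / 2) Λ*(θ))`, the half arising because pairs of new
vertices serve two degrees. Against the lower bound for `P` obtained by tilting the edge
probability, this leaves `exp (l k (Λ*(θ) / 2 + o(1)))`, which `n ^ (-l)` beats with room to spare.
-/

namespace BernoulliProduct

/-! ### Finite products of Bernoulli measures -/

variable {E : Type*}

/-- `f` only depends on the coordinates in `A`. -/
def SupportedOn {β : Type*} (f : (E → Bool) → β) (A : Set E) : Prop :=
  ∀ ω ω', (∀ e ∈ A, ω e = ω' e) → f ω = f ω'

theorem SupportedOn.indicator {B : Set (E → Bool)} {A : Set E} (h : SupportedOn (· ∈ B) A) :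
    SupportedOn (B.indicator (1 : (E → Bool) → ℝ)) A := fun ω ω' hω => by
  have := h ω ω' hω
  simp only [eq_iff_iff] at this
  by_cases h' : ω' ∈ B <;> simp [h', this]

variable [Fintype E]

/-- The probability of the outcome `ω` when the coordinates are independent and the coordinate `e`
is `true` with probability `π e`. -/
noncomputable def weight (π : E → ℝ) (ω : E → Bool) : ℝ :=
  ∏ e, if ω e then π e else 1 - π e

variable {π : E → ℝ}

theorem weight_nonneg (h0 : 0 ≤ π) (h1 : π ≤ 1) (ω : E → Bool) : 0 ≤ weight π ω := by
  refine Finset.prod_nonneg fun e _ => ?_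
  have a := h0 e
  have b := h1 e
  simp only [Pi.zero_apply, Pi.one_apply] at a b
  split_ifs <;> linarith

/-- The lattice condition of the FKG inequality, which holds with equality for product measures. -/
theorem weight_mul_weight (ω ω' : E → Bool) :
    weight π ω * weight π ω' = weight π (ω ⊓ ω') * weight π (ω ⊔ ω') := by
  simp only [weight, ← Finset.prod_mul_distrib]
  refine Finset.prod_congr rfl fun e _ => ?_
  cases h : ω e <;> cases h' : ω' e <;> simp [h, h', mul_comm]

variable [DecidableEq E]

/-- The expectation of `f` under the product of Bernoulli distributions. -/
noncomputable def mean (π : E → ℝ) (f : (E → Bool) → ℝ) : ℝ :=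
  ∑ ω, weight π ω * f ω

/-- The probability of the event `B` under the product of Bernoulli distributions. -/
noncomputable def prob (π : E → ℝ) (B : Set (E → Bool)) : ℝ :=
  mean π (B.indicator 1)

theorem mean_prod (g : E → Bool → ℝ) :
    mean π (fun ω => ∏ e, g e (ω e)) = ∏ e, (π e * g e true + (1 - π e) * g e false) := by
  have h : ∀ e, π e * g e true + (1 - π e) * g e false =
      ∑ b : Bool, (if b then π e else 1 - π e) * g e b := fun e => by simp
  simp only [h]
  rw [Finset.prod_univ_sum, Fintype.piFinset_univ, mean]
  simp only [weight, Finset.prod_mul_distrib]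

theorem mean_const (c : ℝ) : mean π (fun _ => c) = c := by
  have h := mean_prod (π := π) (fun _ _ => (1 : ℝ))
  have h' : mean π (fun _ => (1 : ℝ)) = 1 := by simpa using h
  have : mean π (fun _ => c) = mean π (fun _ => (1 : ℝ)) * c := by
    simp [mean, Finset.sum_mul]
  rw [this, h', one_mul]

theorem sum_weight : ∑ ω, weight π ω = 1 := by
  simpa [mean] using mean_const (π := π) 1

theorem mean_mono (h0 : 0 ≤ π) (h1 : π ≤ 1) {f g : (E → Bool) → ℝ} (h : ∀ ω, f ω ≤ g ω) :
    mean π f ≤ mean π g :=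
  Finset.sum_le_sum fun ω _ => mul_le_mul_of_nonneg_left (h ω) (weight_nonneg h0 h1 ω)

theorem mean_sub (f g : (E → Bool) → ℝ) :
    mean π (fun ω => f ω - g ω) = mean π f - mean π g := by
  simp [mean, mul_sub, Finset.sum_sub_distrib]

theorem mean_sum {ι : Type*} (s : Finset ι) (f : ι → (E → Bool) → ℝ) :
    mean π (fun ω => ∑ i ∈ s, f i ω) = ∑ i ∈ s, mean π (f i) := by
  simp only [mean, Finset.mul_sum]
  exact Finset.sum_comm

theorem mean_const_mul (c : ℝ) (f : (E → Bool) → ℝ) :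
    mean π (fun ω => c * f ω) = c * mean π f := by
  simp only [mean, Finset.mul_sum]
  exact Finset.sum_congr rfl fun ω _ => by ring

theorem exists_mean_le (h0 : 0 ≤ π) (h1 : π ≤ 1) (f : (E → Bool) → ℝ) :
    ∃ ω, mean π f ≤ f ω := by
  by_contra! h
  obtain ⟨ω₀, -, hω₀⟩ := Finset.exists_max_image Finset.univ f ⟨fun _ => true, by simp⟩
  have := mean_mono h0 h1 (fun ω => hω₀ ω (Finset.mem_univ ω))
  rw [mean_const] at this
  exact (h ω₀).not_ge this

theorem prob_nonneg (h0 : 0 ≤ π) (h1 : π ≤ 1) (B : Set (E → Bool)) : 0 ≤ prob π B := by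
  have := mean_mono h0 h1 (f := fun _ => 0) (g := B.indicator 1) fun ω => by
    by_cases h : ω ∈ B <;> simp [h]
  rwa [mean_const] at this

theorem prob_mono (h0 : 0 ≤ π) (h1 : π ≤ 1) {B C : Set (E → Bool)} (h : B ⊆ C) :
    prob π B ≤ prob π C :=
  mean_mono h0 h1 fun ω => Set.indicator_le_indicator_of_subset h (fun _ => zero_le_one) ω

theorem prob_compl (B : Set (E → Bool)) : prob π Bᶜ = 1 - prob π B := by
  rw [prob, prob, ← mean_const (π := π) 1, ← mean_sub]
  congr 1
  ext ω
  by_cases h : ω ∈ B <;> simp [h]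

theorem prob_diff (B C : Set (E → Bool)) : prob π (B \ C) = prob π B - prob π (B ∩ C) := by
  rw [prob, prob, prob, ← mean_sub]
  congr 1
  ext ω
  by_cases h : ω ∈ B <;> by_cases h' : ω ∈ C <;> simp [h, h']

theorem prob_biUnion_le (h0 : 0 ≤ π) (h1 : π ≤ 1) {ι : Type*} (s : Finset ι)
    (B : ι → Set (E → Bool)) : prob π (⋃ i ∈ s, B i) ≤ ∑ i ∈ s, prob π (B i) := by
  simp only [prob]
  rw [← mean_sum]
  refine mean_mono h0 h1 fun ω => ?_
  by_cases h : ω ∈ ⋃ i ∈ s, B i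
  · obtain ⟨i, hi, hω⟩ := Set.mem_iUnion₂.1 h
    rw [Set.indicator_of_mem h]
    refine le_trans ?_ (Finset.single_le_sum (f := fun i => (B i).indicator (1 : (E → Bool) → ℝ) ω)
      (fun j _ => Set.indicator_nonneg (fun _ _ => zero_le_one) ω) hi)
    simp [hω]
  · rw [Set.indicator_of_notMem h]
    exact Finset.sum_nonneg fun j _ => Set.indicator_nonneg (fun _ _ => zero_le_one) ω

theorem prob_le_mean (h0 : 0 ≤ π) (h1 : π ≤ 1) {B : Set (E → Bool)} {f : (E → Bool) → ℝ}
    (hf : ∀ ω, 0 ≤ f ω) (hB : ∀ ω ∈ B, 1 ≤ f ω) : prob π B ≤ mean π f :=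
  mean_mono h0 h1 fun ω => by
    by_cases h : ω ∈ B
    · simpa [h] using hB ω h
    · simpa [h] using hf ω

/-- Functions of disjoint sets of coordinates are independent. -/
theorem mean_mul_of_disjoint {f g : (E → Bool) → ℝ} {A B : Set E} (hf : SupportedOn f A)
    (hg : SupportedOn g B) (hAB : Disjoint A B) :
    mean π (fun ω => f ω * g ω) = mean π f * mean π g := by
  classical
  -- Take two independent copies and exchange their coordinates outside `A`. The exchange preserves
  -- the product weight and turns `f x.1 * g x.1` into `f x.1 * g x.2`.
  let mix : (E → Bool) → (E → Bool) → E → Bool := fun ω ω' e => if e ∈ A then ω e else ω' e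
  let σ : (E → Bool) × (E → Bool) → (E → Bool) × (E → Bool) :=
    fun x => (mix x.1 x.2, mix x.2 x.1)
  have hσ : Function.Involutive σ := fun x => by
    ext e <;> by_cases h : e ∈ A <;> simp [σ, mix, h]
  have hw : ∀ ω ω', weight π (mix ω ω') * weight π (mix ω' ω) = weight π ω * weight π ω' := by
    intro ω ω'
    simp only [weight, ← Finset.prod_mul_distrib]
    refine Finset.prod_congr rfl fun e _ => ?_
    by_cases h : e ∈ A <;> simp [mix, h, mul_comm]
  have hf' : ∀ ω ω', f (mix ω ω') = f ω := fun ω ω' => hf _ _ fun e he => by simp [mix, he]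
  have hg' : ∀ ω ω', g (mix ω' ω) = g ω := fun ω ω' => hg _ _ fun e he => by
    simp [mix, hAB.notMem_of_mem_right he]
  calc mean π (fun ω => f ω * g ω)
      = ∑ x : (E → Bool) × (E → Bool), weight π x.1 * weight π x.2 * (f x.1 * g x.1) := by
        rw [Fintype.sum_prod_type, mean]
        refine Finset.sum_congr rfl fun ω _ => ?_
        simp only [mul_right_comm _ (weight π _)]
        rw [← Finset.mul_sum, sum_weight, mul_one]
    _ = ∑ x : (E → Bool) × (E → Bool), weight π x.1 * weight π x.2 * (f x.1 * g x.2) := by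
        rw [← Equiv.sum_comp hσ.toPerm]
        refine Finset.sum_congr rfl fun x _ => ?_
        simp only [Function.Involutive.coe_toPerm, σ, hw, hf', hg']
    _ = mean π f * mean π g := by
        rw [Fintype.sum_prod_type, mean, mean, Finset.sum_mul_sum]
        exact Finset.sum_congr rfl fun ω _ => Finset.sum_congr rfl fun ω' _ => by ring

theorem prob_inter_of_disjoint {B C : Set (E → Bool)} {A A' : Set E}
    (hB : SupportedOn (· ∈ B) A) (hC : SupportedOn (· ∈ C) A') (h : Disjoint A A') :
    prob π (B ∩ C) = prob π B * prob π C := by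
  rw [prob, prob, prob, ← mean_mul_of_disjoint hB.indicator hC.indicator h]
  congr 1
  ext ω
  by_cases h : ω ∈ B <;> by_cases h' : ω ∈ C <;> simp [h, h']

/-! ### Harris and Janson inequalities for down-sets -/

/-- **Harris' inequality**: a down-set and an up-set are negatively correlated. -/
theorem prob_inter_le_of_isLowerSet_of_isUpperSet (h0 : 0 ≤ π) (h1 : π ≤ 1)
    {B C : Set (E → Bool)} (hB : IsLowerSet B) (hC : IsUpperSet C) :
    prob π (B ∩ C) ≤ prob π B * prob π C := by
  have hmono : ∀ {D : Set (E → Bool)}, IsUpperSet D →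
      Monotone (D.indicator (1 : (E → Bool) → ℝ)) := by
    intro D hD ω ω' h
    by_cases h' : ω ∈ D
    · simp [h', hD h h']
    · rw [Set.indicator_of_notMem h']
      exact Set.indicator_nonneg (fun _ _ => zero_le_one) _
  -- FKG concerns two increasing functions, so it is applied to the complement of `B`; taking
  -- complements back reverses the inequality.
  have h := fkg (μ := weight π) (f := Bᶜ.indicator 1) (g := C.indicator 1)
    (fun ω => weight_nonneg h0 h1 ω) (fun ω => Set.indicator_nonneg (fun _ _ => zero_le_one) _)
    (fun ω => Set.indicator_nonneg (fun _ _ => zero_le_one) _) (hmono hB.compl) (hmono hC)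
    (fun ω ω' => (weight_mul_weight ω ω').le)
  rw [sum_weight, one_mul] at h
  have e : ∑ ω, weight π ω * (Bᶜ.indicator 1 ω * C.indicator 1 ω) = prob π (C \ B) := by
    rw [prob, mean]
    refine Finset.sum_congr rfl fun ω _ => ?_
    by_cases h : ω ∈ B <;> by_cases h' : ω ∈ C <;> simp [h, h']
  have h2 : prob π Bᶜ * prob π C ≤ prob π (C \ B) := by
    rw [← e]; exact h
  rw [prob_compl, prob_diff, Set.inter_comm C B] at h2
  linarith

/-- One step of the Boppana-Spencer argument. -/
theorem prob_iInter_compl_insert_le (h0 : 0 ≤ π) (h1 : π ≤ 1) {ι : Type*} [DecidableEq ι]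
    (B : ι → Set (E → Bool)) (A : ι → Set E) (r : ι → ι → Prop) [DecidableRel r]
    (hB : ∀ i, IsLowerSet (B i)) (hA : ∀ i, SupportedOn (· ∈ B i) (A i))
    (hr : ∀ i j, ¬ r i j → Disjoint (A i) (A j)) (a : ι) (I : Finset ι) :
    prob π (⋂ i ∈ insert a I, (B i)ᶜ) ≤ prob π (⋂ i ∈ I, (B i)ᶜ) *
      (1 - (prob π (B a) - ∑ j ∈ I with r a j, prob π (B a ∩ B j))) := by
  set X : Set (E → Bool) := ⋂ i ∈ I.filter (fun j => ¬ r a j), (B i)ᶜ with hX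
  set Y : Set (E → Bool) := ⋂ i ∈ I, (B i)ᶜ with hY
  set d : ℝ := prob π (B a) - ∑ j ∈ I with r a j, prob π (B a ∩ B j) with hd
  have hYX : Y ⊆ X := by
    intro ω hω
    simp only [hX, hY, Set.mem_iInter] at hω ⊢
    exact fun i hi => hω i (Finset.mem_filter.1 hi).1
  have hXup : IsUpperSet X := isUpperSet_iInter₂ fun i _ => (hB i).compl
  have hXsupp : SupportedOn (· ∈ X) (A a)ᶜ := by
    intro ω ω' h
    simp only [hX, Set.mem_iInter, Set.mem_compl_iff, eq_iff_iff]
    refine forall₂_congr fun i hi => ?_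
    have hdis := hr a i (Finset.mem_filter.1 hi).2
    have := hA i ω ω' fun e he => h e (hdis.notMem_of_mem_right he)
    simp only [eq_iff_iff] at this
    rw [this]
  have hind : prob π (B a ∩ X) = prob π (B a) * prob π X :=
    prob_inter_of_disjoint (hA a) hXsupp disjoint_compl_right
  -- `X` says that all events not related to `a` fail, so it is independent of `B a`. Passing from
  -- `X` to `Y` loses at most the sum of `P(B a ∩ B j ∩ X)` over the related `j`, and Harris bounds
  -- each term by `P(B a ∩ B j) P(X)`. This leaves at least `d P(X) ≥ d P(Y)` when `d > 0`.
  have hkey : d * prob π Y ≤ prob π (B a ∩ Y) := by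
    rcases le_or_gt d 0 with hneg | hpos
    · exact (mul_nonpos_of_nonpos_of_nonneg hneg (prob_nonneg h0 h1 _)).trans
        (prob_nonneg h0 h1 _)
    · have hsub : B a ∩ X ⊆
          (B a ∩ Y) ∪ ⋃ j ∈ I.filter (fun j => r a j), (B a ∩ B j) ∩ X := by
        rintro ω ⟨ha, hx⟩
        by_cases hy : ω ∈ Y
        · exact Or.inl ⟨ha, hy⟩
        · right
          simp only [hY, Set.mem_iInter, not_forall, Set.mem_compl_iff, not_not] at hy
          obtain ⟨j, hj, hjB⟩ := hy
          have hrj : r a j := by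
            by_contra hn
            have := Set.mem_iInter₂.1 hx j (Finset.mem_filter.2 ⟨hj, hn⟩)
            exact this hjB
          exact Set.mem_iUnion₂.2 ⟨j, Finset.mem_filter.2 ⟨hj, hrj⟩, ⟨ha, hjB⟩, hx⟩
      have hdiff : prob π (B a ∩ X) - prob π (B a ∩ Y) ≤
          ∑ j ∈ I with r a j, prob π (B a ∩ B j) * prob π X := by
        have e1 : prob π ((B a ∩ X) \ Y) = prob π (B a ∩ X) - prob π (B a ∩ Y) := by
          rw [prob_diff, Set.inter_assoc, Set.inter_eq_right.2 hYX]
        rw [← e1]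
        refine (prob_mono h0 h1 (C := ⋃ j ∈ I.filter (fun j => r a j), (B a ∩ B j) ∩ X)
          ?_).trans ((prob_biUnion_le h0 h1 _ _).trans (Finset.sum_le_sum fun j _ => ?_))
        · rintro ω ⟨h, hn⟩
          exact (hsub h).resolve_left fun h' => hn h'.2
        · exact prob_inter_le_of_isLowerSet_of_isUpperSet h0 h1 ((hB a).inter (hB j)) hXup
      rw [hind, ← Finset.sum_mul] at hdiff
      have h3 := mul_le_mul_of_nonneg_left (prob_mono h0 h1 hYX) hpos.le
      rw [hd] at h3 ⊢
      nlinarith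
  have e2 : (⋂ i ∈ insert a I, (B i)ᶜ) = Y \ B a := by
    ext ω
    simp only [Finset.mem_insert, Set.iInter_iInter_eq_or_left, Set.mem_inter_iff,
      Set.mem_compl_iff, Set.mem_sdiff, hY]
    tauto
  rw [e2, prob_diff, Set.inter_comm]
  linarith

/-- Multiply the one-step bounds using `1 - d ≤ exp (-d)`. A related pair is charged once, when its
later member is inserted, while the double sum sees it in both orders; hence the factor `1 / 2`. -/
theorem prob_iInter_compl_le_exp (h0 : 0 ≤ π) (h1 : π ≤ 1) {ι : Type*} [DecidableEq ι]
    (B : ι → Set (E → Bool)) (A : ι → Set E) (r : ι → ι → Prop) [DecidableRel r]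
    (hB : ∀ i, IsLowerSet (B i)) (hA : ∀ i, SupportedOn (· ∈ B i) (A i))
    (hr : ∀ i j, ¬ r i j → Disjoint (A i) (A j)) (hsymm : ∀ i j, r i j → r j i)
    (I : Finset ι) :
    prob π (⋂ i ∈ I, (B i)ᶜ) ≤ Real.exp (-(∑ i ∈ I, prob π (B i) -
      1 / 2 * ∑ i ∈ I, ∑ j ∈ I, if i ≠ j ∧ r i j then prob π (B i ∩ B j) else 0)) := by
  induction I using Finset.induction_on with
  | empty =>
    simp [prob, mean, sum_weight]
  | insert a I ha ih =>
    refine (prob_iInter_compl_insert_le h0 h1 B A r hB hA hr a I).trans ?_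
    set d : ℝ := prob π (B a) - ∑ j ∈ I with r a j, prob π (B a ∩ B j) with hd
    have h2 : 1 - d ≤ Real.exp (-d) := by
      have := Real.add_one_le_exp (-d); linarith
    have hsum : ∀ f : ι → ι → ℝ, ∑ i ∈ insert a I, ∑ j ∈ insert a I, f i j =
        f a a + ∑ j ∈ I, f a j + ∑ i ∈ I, f i a + ∑ i ∈ I, ∑ j ∈ I, f i j := by
      intro f
      rw [Finset.sum_insert ha, Finset.sum_insert ha]
      simp only [Finset.sum_insert ha, Finset.sum_add_distrib]
      ring
    have e1 : ∑ j ∈ I, (if a ≠ j ∧ r a j then prob π (B a ∩ B j) else 0) =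
        ∑ j ∈ I with r a j, prob π (B a ∩ B j) := by
      rw [Finset.sum_filter]
      refine Finset.sum_congr rfl fun j hj => ?_
      have : a ≠ j := fun h => ha (h ▸ hj)
      simp [this]
    have e2 : ∑ j ∈ I, (if j ≠ a ∧ r j a then prob π (B j ∩ B a) else 0) =
        ∑ j ∈ I with r a j, prob π (B a ∩ B j) := by
      rw [← e1]
      refine Finset.sum_congr rfl fun j hj => ?_
      have h1 : (j ≠ a ∧ r j a) ↔ (a ≠ j ∧ r a j) :=
        ⟨fun h => ⟨h.1.symm, hsymm _ _ h.2⟩, fun h => ⟨h.1.symm, hsymm _ _ h.2⟩⟩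
      simp only [h1, Set.inter_comm]
    calc prob π (⋂ i ∈ I, (B i)ᶜ) * (1 - d)
        ≤ prob π (⋂ i ∈ I, (B i)ᶜ) * Real.exp (-d) :=
          mul_le_mul_of_nonneg_left h2 (prob_nonneg h0 h1 _)
      _ ≤ _ := mul_le_mul_of_nonneg_right ih (Real.exp_pos _).le
      _ = _ := by
        rw [← Real.exp_add, hsum, e1, e2, Finset.sum_insert ha, hd]
        congr 1
        simp
        ring

/-- The **Janson inequality** for general down-sets (Riordan-Warnke), with a thinning
parameter `x`. -/
theorem janson_thinned (h0 : 0 ≤ π) (h1 : π ≤ 1) {ι : Type*} [Fintype ι] [DecidableEq ι]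
    (B : ι → Set (E → Bool)) (A : ι → Set E) (r : ι → ι → Prop) [DecidableRel r]
    (hB : ∀ i, IsLowerSet (B i)) (hA : ∀ i, SupportedOn (· ∈ B i) (A i))
    (hr : ∀ i j, ¬ r i j → Disjoint (A i) (A j)) (hsymm : ∀ i j, r i j → r j i)
    {x : ℝ} (hx0 : 0 ≤ x) (hx1 : x ≤ 1) :
    prob π (⋂ i, (B i)ᶜ) ≤ Real.exp (-(x * ∑ i, prob π (B i) -
      x ^ 2 / 2 * ∑ i, ∑ j, if i ≠ j ∧ r i j then prob π (B i ∩ B j) else 0)) := by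
  set c : ι → ι → ℝ := fun i j => if i ≠ j ∧ r i j then prob π (B i ∩ B j) else 0 with hc
  -- `u i` indicates that `i` survives in a random subset keeping each index with probability `x`.
  -- The expected exponent for that subset is the claimed one, so some subset does at least as well,
  -- and discarding events only enlarges the intersection of complements.
  let u : ι → (ι → Bool) → ℝ := fun i ξ => if ξ i then 1 else 0
  have hu : ∀ i, mean (fun _ => x) (u i) = x := by
    intro i
    have h := mean_prod (π := fun _ : ι => x) (fun j (b : Bool) => if j = i then (if b then 1 else 0) else 1)
    simpa [Finset.prod_ite_eq, Finset.prod_ite, apply_ite, Finset.filter_eq'] using h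
  have husupp : ∀ i, SupportedOn (u i) {i} := fun i ω ω' h => by simp [u, h i rfl]
  have huu : ∀ i j, i ≠ j → mean (fun _ => x) (fun ξ => u i ξ * u j ξ) = x ^ 2 := by
    intro i j hij
    rw [mean_mul_of_disjoint (husupp i) (husupp j) (by simpa using hij), hu, hu, sq]
  obtain ⟨ξ, hξ⟩ := exists_mean_le (π := fun _ : ι => x) (fun _ => hx0) (fun _ => hx1)
    (fun ξ => ∑ i, prob π (B i) * u i ξ - 1 / 2 * ∑ i, ∑ j, c i j * (u i ξ * u j ξ))
  rw [mean_sub, mean_const_mul, mean_sum, mean_sum] at hξ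
  simp only [mean_sum, mean_const_mul, hu] at hξ
  have e : ∀ i j, c i j * mean (fun _ => x) (fun ξ => u i ξ * u j ξ) = c i j * x ^ 2 := by
    intro i j
    by_cases h : i = j
    · simp [hc, h]
    · rw [huu i j h]
  simp only [e, ← Finset.sum_mul] at hξ
  set I : Finset ι := Finset.univ.filter fun i => ξ i = true with hI
  have hJ := prob_iInter_compl_le_exp h0 h1 B A r hB hA hr hsymm I
  refine (prob_mono h0 h1 ?_).trans (hJ.trans (Real.exp_le_exp.2 ?_))
  · exact fun ω hω => Set.mem_iInter₂.2 fun i _ => Set.mem_iInter.1 hω i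
  · have e1 : ∑ i, prob π (B i) * u i ξ = ∑ i ∈ I, prob π (B i) := by
      simp [hI, Finset.sum_filter, u]
    have e2 : ∑ i, ∑ j, c i j * (u i ξ * u j ξ) = ∑ i ∈ I, ∑ j ∈ I, c i j := by
      simp only [hI, Finset.sum_filter, u]
      refine Finset.sum_congr rfl fun i _ => ?_
      by_cases h : ξ i <;> simp [h]
    rw [e1, e2] at hξ
    linarith

/-- The **Janson inequality** for general down-sets, in terms of the ratio `Q` of the
correlation sum (diagonal included) and the squared mean. -/
theorem janson (h0 : 0 ≤ π) (h1 : π ≤ 1) {ι : Type*} [Fintype ι] [DecidableEq ι]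
    (B : ι → Set (E → Bool)) (A : ι → Set E) (r : ι → ι → Prop) [DecidableRel r]
    (hB : ∀ i, IsLowerSet (B i)) (hA : ∀ i, SupportedOn (· ∈ B i) (A i))
    (hr : ∀ i j, ¬ r i j → Disjoint (A i) (A j)) (hsymm : ∀ i j, r i j → r j i)
    (hrefl : ∀ i, r i i) {Q : ℝ} (hμ : 0 < ∑ i, prob π (B i))
    (hQ : ∑ i, ∑ j, (if r i j then prob π (B i ∩ B j) else 0) ≤ Q * (∑ i, prob π (B i)) ^ 2) :
    prob π (⋂ i, (B i)ᶜ) ≤ Real.exp (-(1 / (2 * Q))) := by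
  set μ := ∑ i, prob π (B i) with hμ'
  have hnn : ∀ i j, 0 ≤ (if r i j then prob π (B i ∩ B j) else 0) := fun i j => by
    split_ifs
    · exact prob_nonneg h0 h1 _
    · exact le_rfl
  have hdiag : μ ≤ ∑ i, ∑ j, (if r i j then prob π (B i ∩ B j) else 0) := by
    refine Finset.sum_le_sum fun i _ => ?_
    refine le_trans ?_ (Finset.single_le_sum (fun j _ => hnn i j) (Finset.mem_univ i))
    simp [hrefl]
  have hoff : ∑ i, ∑ j, (if i ≠ j ∧ r i j then prob π (B i ∩ B j) else 0) ≤ Q * μ ^ 2 := by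
    refine le_trans (Finset.sum_le_sum fun i _ => Finset.sum_le_sum fun j _ => ?_) hQ
    by_cases h : i = j
    · simpa [h] using hnn j j
    · simp [h]
  have hQμ : 1 ≤ Q * μ := by
    have : μ * 1 ≤ μ * (Q * μ) := by nlinarith
    exact le_of_mul_le_mul_left this hμ
  have hQ0 : 0 < Q := by
    by_contra! h
    nlinarith
  have hpos : 0 < Q * μ := by positivity
  -- The value `x = 1 / (Q μ)` maximises `x μ - x² Q μ² / 2`. It is at most `1` because the diagonal
  -- terms force `μ ≤ Q μ²`.
  refine (janson_thinned h0 h1 B A r hB hA hr hsymm (x := 1 / (Q * μ)) (by positivity)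
    ((div_le_one hpos).2 hQμ)).trans (Real.exp_le_exp.2 ?_)
  have h3 := mul_le_mul_of_nonneg_left hoff
    (show 0 ≤ (1 / (Q * μ)) ^ 2 / 2 by positivity)
  have e1 : (1 / (Q * μ)) ^ 2 / 2 * (Q * μ ^ 2) = 1 / (2 * Q) := by field_simp
  have e2 : 1 / (Q * μ) * μ = 2 * (1 / (2 * Q)) := by field_simp
  rw [e1] at h3
  rw [e2]
  linarith

/-! ### Symmetry, decoupling and change of measure -/

theorem mean_comp_perm (p : ℝ) (σ : Equiv.Perm E) (f : (E → Bool) → ℝ) :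
    mean (fun _ => p) (fun ω => f (ω ∘ σ)) = mean (fun _ => p) f := by
  refine Fintype.sum_equiv (Equiv.arrowCongr σ.symm (Equiv.refl Bool)) _ _ fun ω => ?_
  have h : weight (fun _ => p) (Equiv.arrowCongr σ.symm (Equiv.refl Bool) ω) =
      weight (fun _ => p) ω := Equiv.prod_comp σ (fun e => if ω e then p else 1 - p)
  rw [h]
  rfl

theorem prob_preimage_perm (p : ℝ) (σ : Equiv.Perm E) (B : Set (E → Bool)) :
    prob (fun _ => p) ((fun ω => ω ∘ σ) ⁻¹' B) = prob (fun _ => p) B :=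
  mean_comp_perm p σ (B.indicator 1)

theorem mean_prod_finset (A : Finset E) (g : E → Bool → ℝ) :
    mean π (fun ω => ∏ e ∈ A, g e (ω e)) =
      ∏ e ∈ A, (π e * g e true + (1 - π e) * g e false) := by
  have h := mean_prod (π := π) fun e b => if e ∈ A then g e b else 1
  simp only [Finset.prod_ite_mem, Finset.univ_inter] at h
  rw [h, ← Finset.univ_inter A, ← Finset.prod_ite_mem, Finset.univ_inter]
  refine Finset.prod_congr rfl fun e _ => ?_
  split_ifs <;> ring

theorem prob_forall_mem_eq_false (A : Finset E) :
    prob π {ω | ∀ e ∈ A, ω e = false} = ∏ e ∈ A, (1 - π e) := by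
  have h := mean_prod_finset (π := π) A fun _ (b : Bool) => if b then 0 else 1
  simp only [Bool.false_eq_true, if_true, if_false, mul_zero, mul_one, zero_add] at h
  rw [← h, prob]
  congr 1
  ext ω
  by_cases hω : ∀ e ∈ A, ω e = false
  · rw [Set.indicator_of_mem (show ω ∈ {ω | ∀ e ∈ A, ω e = false} from hω),
      Finset.prod_eq_one fun e he => by simp [hω e he]]
    rfl
  · rw [Set.indicator_of_notMem (show ω ∉ {ω | ∀ e ∈ A, ω e = false} from hω)]
    push Not at hω
    obtain ⟨e, he, hωe⟩ := hω
    exact (Finset.prod_eq_zero he (by simpa using hωe)).symm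

/-- The correlation of a down-set with an event that shares only the coordinates in `A` with it. -/
theorem prob_inter_mul_prod_le (h0 : 0 ≤ π) (h1 : π ≤ 1) {B C : Set (E → Bool)} {F F' : Set E}
    (hC : SupportedOn (· ∈ C) F) (hB : SupportedOn (· ∈ B) F') (hlow : IsLowerSet B)
    (A : Finset E) (hA : F ∩ F' ⊆ A) :
    prob π (C ∩ B) * ∏ e ∈ A, (1 - π e) ≤ prob π C * prob π B := by
  -- Clearing the shared coordinates keeps a configuration in the down-set `B`, and the event `B'`
  -- no longer sees what `C` depends on. Conversely `B'` lies inside `B` once all coordinates in `A`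
  -- are false, an independent event whose probability is the product.
  let clear : (E → Bool) → E → Bool := fun ω e => if e ∈ A then false else ω e
  have hclear : ∀ ω, clear ω ≤ ω := fun ω e => by
    by_cases h : e ∈ A <;> simp [clear, h]
  set B' : Set (E → Bool) := clear ⁻¹' B with hB'
  have hsupp : SupportedOn (· ∈ B') (F' \ A) := by
    intro ω ω' h
    refine hB _ _ fun e he => ?_
    by_cases hA : e ∈ A
    · simp [clear, hA]
    · simp [clear, hA, h e ⟨he, hA⟩]
  have h2 : prob π (C ∩ B) ≤ prob π C * prob π B' := by
    rw [← prob_inter_of_disjoint hC hsupp]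
    · exact prob_mono h0 h1 (Set.inter_subset_inter_right _ fun ω hω => hlow (hclear ω) hω)
    · exact Set.disjoint_left.2 fun e he he' => he'.2 (hA ⟨he, he'.1⟩)
  have h3 : prob π B' * ∏ e ∈ A, (1 - π e) ≤ prob π B := by
    have hZ : SupportedOn (· ∈ {ω : E → Bool | ∀ e ∈ A, ω e = false}) (A : Set E) := by
      intro ω ω' h
      simp only [Set.mem_ofPred_eq, eq_iff_iff]
      exact forall₂_congr fun e he => by rw [h e he]
    rw [← prob_forall_mem_eq_false, ← prob_inter_of_disjoint hsupp hZ Set.disjoint_sdiff_left]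
    refine prob_mono h0 h1 fun ω hω => ?_
    have : clear ω = ω := by
      ext e
      by_cases h : e ∈ A
      · simp [clear, h, hω.2 e h]
      · simp [clear, h]
    have h' := hω.1
    rwa [hB', Set.mem_preimage, this] at h'
  have hpr : 0 ≤ ∏ e ∈ A, (1 - π e) :=
    Finset.prod_nonneg fun e _ => sub_nonneg.2 (h1 e)
  calc prob π (C ∩ B) * ∏ e ∈ A, (1 - π e)
      ≤ prob π C * prob π B' * ∏ e ∈ A, (1 - π e) := mul_le_mul_of_nonneg_right h2 hpr
    _ = prob π C * (prob π B' * ∏ e ∈ A, (1 - π e)) := by ring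
    _ ≤ _ := mul_le_mul_of_nonneg_left h3 (prob_nonneg h0 h1 _)

/-- Change of measure: replace the parameters `π` by `π'` at the cost of the likelihood ratio. -/
theorem mul_prob_le_prob (h0 : 0 ≤ π) (h1 : π ≤ 1) {π' : E → ℝ} (h0' : 0 ≤ π') (h1' : π' ≤ 1)
    (L : (E → Bool) → ℝ) (hL : ∀ ω, weight π ω = weight π' ω * L ω) (B : Set (E → Bool)) (ρ : ℝ) :
    ρ * prob π' (B ∩ {ω | ρ ≤ L ω}) ≤ prob π B := by
  rw [prob, prob, ← mean_const_mul]
  refine Finset.sum_le_sum fun ω _ => ?_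
  have hw := weight_nonneg h0 h1 ω
  have hw' := weight_nonneg h0' h1' ω
  by_cases hB : ω ∈ B
  · by_cases hρ : ρ ≤ L ω
    · simp only [Set.mem_inter_iff, hB, Set.mem_ofPred_eq, hρ, and_self, Set.indicator_of_mem,
        Pi.one_apply, mul_one]
      rw [hL]
      exact mul_le_mul_of_nonneg_left hρ hw'
    · simp [hB, hρ, hw]
  · simp [hB]

end BernoulliProduct

open BernoulliProduct

/-! ### Probability and correlation of dependence events -/

section DependentEvent

variable {V : Type*} [DecidableEq V]

/-- The degree of `v` in the graph on `S` whose edges are the non-degenerate pairs marked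
`true` by `ω`. -/
def degreeWithin (ω : Sym2 V → Bool) (S : Finset V) (v : V) : ℕ :=
  ((S.erase v).filter fun u => ω s(u, v) = true).card

/-- The event that all vertices in `O` have degree at most `t` within `S`. -/
def degreesLE (t : ℕ) (S O : Finset V) : Set (Sym2 V → Bool) :=
  {ω | ∀ v ∈ O, degreeWithin ω S v ≤ t}

/-- The pairs of distinct elements of `S`. -/
def pairsWithin (S : Finset V) : Finset (Sym2 V) :=
  S.offDiag.image fun x => s(x.1, x.2)

theorem mk_mem_pairsWithin {S : Finset V} {u v : V} :
    s(u, v) ∈ pairsWithin S ↔ u ∈ S ∧ v ∈ S ∧ u ≠ v := by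
  simp only [pairsWithin, Finset.mem_image, Finset.mem_offDiag, Prod.exists, Sym2.eq_iff]
  constructor
  · rintro ⟨a, b, ⟨ha, hb, hab⟩, ⟨rfl, rfl⟩ | ⟨rfl, rfl⟩⟩
    · exact ⟨ha, hb, hab⟩
    · exact ⟨hb, ha, hab.symm⟩
  · rintro h
    exact ⟨u, v, h, Or.inl ⟨rfl, rfl⟩⟩

theorem card_pairsWithin (S : Finset V) : (pairsWithin S).card = S.card.choose 2 :=
  Sym2.card_image_offDiag S

theorem pairsWithin_inter (S S' : Finset V) :
    pairsWithin (S ∩ S') = pairsWithin S ∩ pairsWithin S' := by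
  ext e
  induction e with
  | h u v =>
    simp only [Finset.mem_inter, mk_mem_pairsWithin]
    tauto

theorem degreeWithin_mono {ω ω' : Sym2 V → Bool} (h : ω ≤ ω') (S : Finset V) (v : V) :
    degreeWithin ω S v ≤ degreeWithin ω' S v := by
  refine Finset.card_le_card fun u hu => ?_
  rw [Finset.mem_filter] at hu ⊢
  exact ⟨hu.1, by simpa using (Bool.le_iff_imp.1 (h s(u, v))) hu.2⟩

theorem isLowerSet_degreesLE (t : ℕ) (S O : Finset V) : IsLowerSet (degreesLE t S O) :=
  fun _ _ h hω v hv => (degreeWithin_mono h S v).trans (hω v hv)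

theorem degreeWithin_congr {ω ω' : Sym2 V → Bool} {S : Finset V} {v : V}
    (h : ∀ u ∈ S, u ≠ v → ω s(u, v) = ω' s(u, v)) : degreeWithin ω S v = degreeWithin ω' S v := by
  refine congrArg Finset.card (Finset.filter_congr fun u hu => ?_)
  rw [h u (Finset.mem_of_mem_erase hu) (Finset.ne_of_mem_erase hu)]

theorem supportedOn_degreesLE (t : ℕ) (S O : Finset V) :
    SupportedOn (· ∈ degreesLE t S O) {e | ∃ u ∈ S, ∃ v ∈ O, u ≠ v ∧ e = s(u, v)} := by
  intro ω ω' h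
  simp only [degreesLE, Set.mem_ofPred_eq, eq_iff_iff]
  refine forall₂_congr fun v hv => ?_
  rw [degreeWithin_congr fun u hu huv => h _ ⟨u, hu, v, hv, huv, rfl⟩]

theorem supportedOn_degreesLE_self (t : ℕ) (S : Finset V) :
    SupportedOn (· ∈ degreesLE t S S) (pairsWithin S : Set (Sym2 V)) := by
  refine fun ω ω' h => supportedOn_degreesLE t S S ω ω' ?_
  rintro _ ⟨u, hu, v, hv, huv, rfl⟩
  exact h _ (mk_mem_pairsWithin.2 ⟨hu, hv, huv⟩)

theorem disjoint_pairsWithin {S S' : Finset V} (h : (S ∩ S').card ≤ 1) :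
    Disjoint (pairsWithin S : Set (Sym2 V)) (pairsWithin S') := by
  rw [Finset.disjoint_coe, Finset.disjoint_iff_inter_eq_empty, ← pairsWithin_inter,
    ← Finset.card_eq_zero, card_pairsWithin, Nat.choose_eq_zero_of_lt (by omega)]

variable [Fintype V]

/-- A vertex permutation carrying `S` to `S'` induces a permutation of the pairs, and all pairs have
the same edge probability. -/
theorem prob_degreesLE_eq_of_card_eq (p : ℝ) (t : ℕ) {S S' : Finset V} (h : S.card = S'.card) :
    prob (fun _ => p) (degreesLE t S S) = prob (fun _ => p) (degreesLE t S' S') := by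
  let e : {x // x ∈ S} ≃ {x // x ∈ S'} := Finset.equivOfCardEq h
  let σ : Equiv.Perm V := e.extendSubtype
  have hσ : S.map σ.toEmbedding = S' := by
    refine Finset.eq_of_subset_of_card_le (fun x hx => ?_) (by simp [h])
    obtain ⟨y, hy, rfl⟩ := Finset.mem_map.1 hx
    exact e.extendSubtype_mem y hy
  let σ' : Equiv.Perm (Sym2 V) := Equiv.ofBijective (Sym2.map σ)
    (Finite.injective_iff_bijective.1 (Sym2.map.injective σ.injective))
  rw [← prob_preimage_perm p σ']
  congr 1
  ext ω
  have hdeg : ∀ v, degreeWithin (ω ∘ σ') S v = degreeWithin ω S' (σ v) := by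
    intro v
    rw [degreeWithin, degreeWithin, ← hσ, ← Finset.card_map σ.toEmbedding]
    congr 1
    ext u
    obtain ⟨u, rfl⟩ := σ.surjective u
    simp only [σ', Finset.mem_map_equiv, Finset.mem_filter, Finset.mem_erase, Function.comp_apply,
      Equiv.ofBijective_apply, Sym2.map_mk, Equiv.symm_apply_apply, ne_eq, EmbeddingLike.apply_eq_iff_eq]
  simp only [degreesLE, Set.mem_preimage, Set.mem_ofPred_eq, hdeg, ← hσ, Finset.forall_mem_map]
  rfl

/-- The two events share exactly the pairs inside `S ∩ S'`, so this is the cost of forcing those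
pairs to be non-edges. It is effective for small overlaps. -/
theorem prob_degreesLE_inter_mul_pow_le {p : ℝ} (hp0 : 0 ≤ p) (hp1 : p ≤ 1) (t : ℕ)
    (S S' : Finset V) :
    prob (fun _ => p) (degreesLE t S S ∩ degreesLE t S' S') *
        (1 - p) ^ (S ∩ S').card.choose 2 ≤
      prob (fun _ => p) (degreesLE t S S) * prob (fun _ => p) (degreesLE t S' S') := by
  have h := prob_inter_mul_prod_le (π := fun _ : Sym2 V => p) (fun _ => hp0) (fun _ => hp1)
    (supportedOn_degreesLE_self t S) (supportedOn_degreesLE_self t S')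
    (isLowerSet_degreesLE t S' S') (pairsWithin (S ∩ S'))
    (by rw [pairsWithin_inter, Finset.coe_inter])
  rwa [Finset.prod_const, card_pairsWithin] at h

/-- The moment generating function of a sum of degrees: each pair is counted at most twice. -/
theorem mean_prod_pairs_le {p β ψ : ℝ} (hp0 : 0 ≤ p) (hp1 : p ≤ 1) (hβ : 0 ≤ β)
    (h1 : 1 - p + p * β ≤ ψ) (h2 : 1 - p + p * β ^ 2 ≤ ψ ^ 2) (Q : Finset (V × V)) :
    mean (fun _ => p) (fun ω => ∏ x ∈ Q, if ω s(x.1, x.2) then β else 1) ≤ ψ ^ Q.card := by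
  -- Multiplicity of an unordered pair in `Q`: the hypotheses `h1` and `h2` treat the multiplicities
  -- `1` and `2`, giving one factor `ψ` per ordered pair.
  let c : Sym2 V → ℕ := fun e => (Q.filter fun x => s(x.1, x.2) = e).card
  have hc : ∀ e, c e ≤ 2 := by
    intro e
    induction e with
    | h a b =>
      refine (Finset.card_le_card (t := {(a, b), (b, a)}) fun x hx => ?_).trans
        Finset.card_le_two
      have := (Finset.mem_filter.1 hx).2
      rw [Sym2.eq_iff] at this
      rcases x with ⟨x, y⟩
      rcases this with ⟨rfl, rfl⟩ | ⟨rfl, rfl⟩ <;> simp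
  have e1 : ∀ ω : Sym2 V → Bool, (∏ x ∈ Q, if ω s(x.1, x.2) then β else 1) =
      ∏ e, if ω e then β ^ c e else 1 := by
    intro ω
    rw [← Finset.prod_fiberwise Q fun x => s(x.1, x.2)]
    refine Finset.prod_congr rfl fun e _ => ?_
    rw [Finset.prod_congr rfl (g := fun _ => if ω e then β else 1) fun x hx => by
      rw [(Finset.mem_filter.1 hx).2], Finset.prod_const]
    split_ifs <;> simp [c]
  have hcard : Q.card = ∑ e, c e :=
    Finset.card_eq_sum_card_fiberwise fun x _ => Finset.mem_coe.2 (Finset.mem_univ _)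
  simp only [e1]
  have h := mean_prod (π := fun _ : Sym2 V => p) fun e b => if b then β ^ c e else 1
  rw [h, hcard, ← Finset.prod_pow_eq_pow_sum]
  refine Finset.prod_le_prod (fun e _ => ?_) fun e _ => ?_
  · have := pow_nonneg hβ (c e)
    simp only [if_true, Bool.false_eq_true, if_false]
    have : 0 ≤ 1 - p := by linarith
    positivity
  · simp only [if_true, Bool.false_eq_true, if_false]
    have h3 := hc e
    interval_cases c e
    · simp
    · linarith
    · linarith

/-- Chernoff's bound for the event that all vertices of `O ⊆ S` have small degree. -/
theorem prob_degreesLE_mul_pow_le {p β ψ : ℝ} (hp0 : 0 ≤ p) (hp1 : p ≤ 1) (hβ : 0 < β)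
    (hβ1 : β ≤ 1) (h1 : 1 - p + p * β ≤ ψ) (h2 : 1 - p + p * β ^ 2 ≤ ψ ^ 2) (t : ℕ)
    {S O : Finset V} (hO : O ⊆ S) :
    prob (fun _ => p) (degreesLE t S O) * (β ^ t) ^ O.card ≤ (ψ ^ (S.card - 1)) ^ O.card := by
  -- `Q` indexes the degree sum over `O`: a pair inside `O` occurs in both orders, a pair from `O`
  -- to the rest of `S` once.
  set Q : Finset (V × V) := (S ×ˢ O).filter fun x => x.1 ≠ x.2 with hQ
  have hsum : ∀ f : V × V → ℕ, ∑ x ∈ Q, f x = ∑ v ∈ O, ∑ u ∈ S.erase v, f (u, v) := by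
    intro f
    rw [hQ, Finset.sum_filter, Finset.sum_product_right]
    refine Finset.sum_congr rfl fun v _ => ?_
    rw [← Finset.sum_filter, Finset.filter_ne']
  have hcard : Q.card = (S.card - 1) * O.card := by
    rw [Finset.card_eq_sum_ones, hsum]
    simp only [Finset.sum_const, smul_eq_mul, mul_one]
    rw [Finset.sum_congr rfl fun v hv => Finset.card_erase_of_mem (hO hv), Finset.sum_const,
      smul_eq_mul, mul_comm]
  have hprod : ∀ ω : Sym2 V → Bool, (∏ x ∈ Q, if ω s(x.1, x.2) then β else 1) =
      β ^ ∑ v ∈ O, degreeWithin ω S v := by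
    intro ω
    rw [Finset.prod_ite, Finset.prod_const_one, mul_one, Finset.prod_const,
      Finset.card_filter, hsum]
    congr 1
    refine Finset.sum_congr rfl fun v _ => ?_
    rw [degreeWithin, Finset.card_filter]
  have h := mean_prod_pairs_le hp0 hp1 hβ.le h1 h2 Q
  rw [hcard, pow_mul] at h
  refine le_trans ?_ h
  rw [mul_comm, prob, ← mean_const_mul]
  refine mean_mono (fun _ => hp0) (fun _ => hp1) fun ω => ?_
  rw [hprod]
  by_cases hω : ω ∈ degreesLE t S O
  · rw [Set.indicator_of_mem hω, Pi.one_apply, mul_one, ← pow_mul]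
    refine pow_le_pow_of_le_one hβ.le hβ1 ?_
    rw [mul_comm]
    exact Finset.sum_le_card_nsmul O _ t hω
  · rw [Set.indicator_of_notMem hω, mul_zero]
    positivity

/-- The correlation of two dependence events is bounded by that of the first one and the degree
condition on the new vertices. -/
theorem prob_degreesLE_inter_le {p β ψ : ℝ} (hp0 : 0 ≤ p) (hp1 : p ≤ 1) (hβ : 0 < β)
    (hβ1 : β ≤ 1) (h1 : 1 - p + p * β ≤ ψ) (h2 : 1 - p + p * β ^ 2 ≤ ψ ^ 2) (t : ℕ)
    (S S' : Finset V) :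
    prob (fun _ => p) (degreesLE t S S ∩ degreesLE t S' S') ≤
      prob (fun _ => p) (degreesLE t S S) *
        (ψ ^ (S'.card - 1) / β ^ t) ^ (S' \ S).card := by
  have h := prob_degreesLE_mul_pow_le hp0 hp1 hβ hβ1 h1 h2 t (Finset.sdiff_subset (s := S') (t := S))
  rw [← le_div_iff₀ (by positivity), ← div_pow] at h
  have hdis : Disjoint (pairsWithin S : Set (Sym2 V))
      {e | ∃ u ∈ S', ∃ v ∈ S' \ S, u ≠ v ∧ e = s(u, v)} := by
    rw [Set.disjoint_left]
    rintro _ he ⟨u, hu, v, hv, -, rfl⟩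
    exact (Finset.mem_sdiff.1 hv).2 (mk_mem_pairsWithin.1 (Finset.mem_coe.1 he)).2.1
  calc prob (fun _ => p) (degreesLE t S S ∩ degreesLE t S' S')
      ≤ prob (fun _ => p) (degreesLE t S S ∩ degreesLE t S' (S' \ S)) :=
        prob_mono (fun _ => hp0) (fun _ => hp1) (Set.inter_subset_inter_right _
          fun ω hω v hv => hω v (Finset.sdiff_subset hv))
    _ = prob (fun _ => p) (degreesLE t S S) * prob (fun _ => p) (degreesLE t S' (S' \ S)) :=
        prob_inter_of_disjoint (supportedOn_degreesLE_self t S) (supportedOn_degreesLE _ _ _) hdis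
    _ ≤ _ := mul_le_mul_of_nonneg_left h (prob_nonneg (fun _ => hp0) (fun _ => hp1) _)

/-- Chernoff's bound for the event that some vertex of `S` has large degree. -/
theorem prob_compl_degreesLE_le {π : Sym2 V → ℝ} (h0 : 0 ≤ π) (h1 : π ≤ 1) {y b : ℝ}
    (hb : 1 ≤ b) (t : ℕ) (S : Finset V) (hπ : ∀ e ∈ pairsWithin S, π e = y) :
    prob π (degreesLE t S S)ᶜ ≤ S.card * ((1 - y + y * b) ^ (S.card - 1) / b ^ (t + 1)) := by
  have hb0 : 0 < b := by linarith
  have hsub : (degreesLE t S S)ᶜ ⊆ ⋃ v ∈ S, {ω | t + 1 ≤ degreeWithin ω S v} := by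
    intro ω hω
    simp only [degreesLE, Set.mem_compl_iff, Set.mem_ofPred_eq, not_forall, not_le] at hω
    obtain ⟨v, hv, hlt⟩ := hω
    exact Set.mem_iUnion₂.2 ⟨v, hv, hlt⟩
  refine (prob_mono h0 h1 hsub).trans ((prob_biUnion_le h0 h1 _ _).trans ?_)
  rw [← nsmul_eq_mul]
  refine Finset.sum_le_card_nsmul S _ _ fun v hv => ?_
  have hinj : Set.InjOn (fun u => s(u, v)) (S.erase v : Finset V) := fun a _ c _ h => by
    have := (Sym2.eq_iff.1 h)
    rcases this with ⟨h, -⟩ | ⟨h, h'⟩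
    · exact h
    · exact h.trans h'
  have hm := mean_prod_finset (π := π) ((S.erase v).image fun u => s(u, v))
    fun _ (c : Bool) => if c then b else 1
  simp only [Finset.prod_image hinj, if_true, Bool.false_eq_true, if_false] at hm
  rw [Finset.prod_congr rfl (g := fun _ => 1 - y + y * b) fun u hu => by
    rw [hπ _ (mk_mem_pairsWithin.2 ⟨Finset.mem_of_mem_erase hu, hv, Finset.ne_of_mem_erase hu⟩)]
    ring, Finset.prod_const, Finset.card_erase_of_mem hv] at hm
  rw [← hm, div_eq_inv_mul, ← mean_const_mul]
  refine prob_le_mean h0 h1 (fun ω => ?_) fun ω hω => ?_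
  · refine mul_nonneg (by positivity) (Finset.prod_nonneg fun u _ => ?_)
    split_ifs <;> linarith
  · have : (∏ u ∈ S.erase v, if ω s(u, v) then b else 1) = b ^ degreeWithin ω S v := by
      rw [Finset.prod_ite, Finset.prod_const_one, mul_one, Finset.prod_const]
      rfl
    rw [this, ← div_eq_inv_mul, one_le_div (by positivity)]
    exact pow_le_pow_right₀ hb hω

/-- A Markov bound on the event that fewer than `(y - η) |A|` coordinates in `A` are `true`. -/
theorem BernoulliProduct.prob_card_lt_le {E : Type*} [Fintype E] [DecidableEq E] {π : E → ℝ}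
    (h0 : 0 ≤ π) (h1 : π ≤ 1) {y η : ℝ} (hy : y ≤ 1) (hη : 0 < η) (A : Finset E)
    (hπ : ∀ e ∈ A, π e = y) :
    prob π {ω | ((A.filter fun e => ω e = true).card : ℝ) < (y - η) * A.card} ≤
      (1 - y) / (1 - y + η) := by
  have hpos : 0 < 1 - y + η := by linarith
  rcases A.eq_empty_or_nonempty with rfl | hA
  · have : (1 - y) / (1 - y + η) ≥ 0 := div_nonneg (by linarith) hpos.le
    simpa [prob, mean] using this
  have hN : (0 : ℝ) < A.card := by exact_mod_cast hA.card_pos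
  have hm : mean π (fun ω => ∑ e ∈ A, if ω e then (0 : ℝ) else 1) = A.card * (1 - y) := by
    rw [mean_sum, ← nsmul_eq_mul]
    refine Finset.sum_eq_card_nsmul fun e he => ?_
    have h := mean_prod_finset (π := π) {e} fun _ (c : Bool) => if c then (0 : ℝ) else 1
    simpa [hπ e he] using h
  have e1 : (1 - y) / (1 - y + η) = ((1 - y + η) * A.card)⁻¹ *
      mean π (fun ω => ∑ e ∈ A, if ω e then (0 : ℝ) else 1) := by
    rw [hm]; field_simp
  rw [e1, ← mean_const_mul]
  refine prob_le_mean h0 h1 (fun ω => ?_) fun ω hω => ?_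
  · exact mul_nonneg (by positivity) (Finset.sum_nonneg fun e _ => by split_ifs <;> norm_num)
  · rw [← div_eq_inv_mul, one_le_div (by positivity)]
    have e2 : ∑ e ∈ A, (if ω e then (0 : ℝ) else 1) =
        A.card - (A.filter fun e => ω e = true).card := by
      rw [eq_sub_iff_add_eq, Finset.card_filter, Nat.cast_sum, ← Finset.sum_add_distrib,
        Finset.card_eq_sum_ones, Nat.cast_sum]
      refine Finset.sum_congr rfl fun e _ => ?_
      split_ifs <;> simp
    rw [e2]
    simp only [Set.mem_ofPred_eq] at hω
    linarith

/-- A lower bound for the probability of dependence, by tilting the edge probability to `y`. -/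
theorem exp_mul_le_prob_degreesLE {p y η b : ℝ} (hp1 : p < 1) (hy0 : 0 < y)
    (hyp : y ≤ p) (hη : 0 < η) (hb : 1 ≤ b) (t : ℕ) (S : Finset V) :
    Real.exp (-(S.card.choose 2 *
        (rateFn p y + η * (Real.log (p / y) - Real.log ((1 - p) / (1 - y)))))) *
      (1 - S.card * ((1 - y + y * b) ^ (S.card - 1) / b ^ (t + 1)) - (1 - y) / (1 - y + η)) ≤
    prob (fun _ => p) (degreesLE t S S) := by
  have hp0 : 0 < p := by linarith
  have hy1 : 0 < 1 - y := by linarith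
  have hq : 0 < 1 - p := by linarith
  set a := p / y with ha
  set c := (1 - p) / (1 - y) with hc
  have ha0 : 0 < a := by positivity
  have hc0 : 0 < c := by positivity
  set ρ := Real.exp (-(S.card.choose 2 * (rateFn p y + η * (Real.log a - Real.log c)))) with hρ
  set A := pairsWithin S with hA
  let π : Sym2 V → ℝ := fun e => if e ∈ A then y else p
  have hπA : ∀ e ∈ A, π e = y := fun e he => by simp [π, he]
  have hπ0 : 0 ≤ π := fun e => by
    simp only [π, Pi.zero_apply]; split_ifs <;> linarith
  have hπ1 : π ≤ 1 := fun e => by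
    simp only [π, Pi.one_apply]; split_ifs <;> linarith
  -- Likelihood ratio of the two measures. Since `c ≤ a`, it grows with the number of edges, so it
  -- is at least `ρ` as soon as `S` spans at least `(y - η) |A|` of them.
  let L : (Sym2 V → Bool) → ℝ := fun ω => ∏ e ∈ A, if ω e then a else c
  have hL : ∀ ω, weight (fun _ => p) ω = weight π ω * L ω := by
    intro ω
    have : L ω = ∏ e, if e ∈ A then (if ω e then a else c) else 1 := by
      rw [Finset.prod_ite_mem, Finset.univ_inter]
    rw [this, weight, weight, ← Finset.prod_mul_distrib]
    refine Finset.prod_congr rfl fun e _ => ?_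
    by_cases he : e ∈ A <;> by_cases hω : ω e = true <;> simp only [π, he, hω, if_true, if_false]
    · rw [ha]; field_simp
    · rw [hc]; simp; field_simp
    · simp
    · simp
  have hac : Real.log c ≤ Real.log a := by
    refine Real.log_le_log hc0 ?_
    rw [hc, ha, div_le_div_iff₀ hy1 hy0]
    nlinarith
  have hrate : rateFn p y = -(y * Real.log a) - (1 - y) * Real.log c := by
    rw [rateFn, ha, hc, ← inv_div p y, ← inv_div (1 - p) (1 - y), Real.log_inv, Real.log_inv]
    ring
  have hLρ : ∀ ω, ¬ (((A.filter fun e => ω e = true).card : ℝ) < (y - η) * A.card) →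
      ρ ≤ L ω := by
    intro ω hω
    rw [not_lt] at hω
    have hLexp : L ω = Real.exp (∑ e ∈ A, if ω e then Real.log a else Real.log c) := by
      rw [Real.exp_sum]
      refine Finset.prod_congr rfl fun e _ => ?_
      split_ifs
      · rw [Real.exp_log ha0]
      · rw [Real.exp_log hc0]
    have hsum : ∑ e ∈ A, (if ω e then Real.log a else Real.log c) = A.card * Real.log c +
        (A.filter fun e => ω e = true).card * (Real.log a - Real.log c) := by
      rw [Finset.card_filter, Nat.cast_sum, Finset.sum_mul, ← nsmul_eq_mul, ← Finset.sum_const,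
        ← Finset.sum_add_distrib]
      refine Finset.sum_congr rfl fun e _ => ?_
      split_ifs <;> simp
    rw [hLexp, hρ, hsum, Real.exp_le_exp, hrate, ← card_pairsWithin]
    have := mul_le_mul_of_nonneg_right hω (sub_nonneg.2 hac)
    linarith
  refine le_trans ?_ (mul_prob_le_prob (fun _ => hp0.le) (fun _ => hp1.le) hπ0 hπ1 L hL
    (degreesLE t S S) ρ)
  refine mul_le_mul_of_nonneg_left ?_ (Real.exp_pos _).le
  have h3 := prob_compl_degreesLE_le hπ0 hπ1 hb t S hπA
  have h4 := prob_card_lt_le hπ0 hπ1 (by linarith : y ≤ 1) hη A hπA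
  set M := {ω : Sym2 V → Bool |
    ((A.filter fun e => ω e = true).card : ℝ) < (y - η) * A.card} with hM
  have h5 : prob π (degreesLE t S S ∩ {ω | ρ ≤ L ω}) ≥ prob π (degreesLE t S S \ M) :=
    prob_mono hπ0 hπ1 fun ω hω => ⟨hω.1, hLρ ω hω.2⟩
  rw [prob_diff] at h5
  have h6 : prob π (degreesLE t S S ∩ M) ≤ prob π M :=
    prob_mono hπ0 hπ1 Set.inter_subset_right
  rw [prob_compl] at h3
  linarith

theorem pow_le_prob_degreesLE {p : ℝ} (hp0 : 0 ≤ p) (hp1 : p ≤ 1) (t : ℕ) (S : Finset V) :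
    (1 - p) ^ S.card.choose 2 ≤ prob (fun _ => p) (degreesLE t S S) := by
  have h := prob_forall_mem_eq_false (π := fun _ : Sym2 V => p) (pairsWithin S)
  rw [Finset.prod_const, card_pairsWithin] at h
  rw [← h]
  refine prob_mono (fun _ => hp0) (fun _ => hp1) fun ω hω v hv => ?_
  rw [degreeWithin, Finset.filter_false_of_mem]
  · simp
  · intro u hu
    simp [hω _ (mk_mem_pairsWithin.2
      ⟨Finset.mem_of_mem_erase hu, hv, Finset.ne_of_mem_erase hu⟩)]

end DependentEvent

/-! ### Counting sets with a prescribed overlap -/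

section Counting

/-- The ratio of the two binomials is the product of `(k - i) / (n - i)` over `i < l`, and each
factor is at most `k / n`. -/
theorem choose_sub_mul_pow_le (n k : ℕ) (hkn : k ≤ n) (l : ℕ) (hl : l ≤ k) :
    (n - l).choose (k - l) * n ^ l ≤ k ^ l * n.choose k := by
  induction l with
  | zero => simp
  | succ l ih =>
    have ih := ih (by omega)
    obtain ⟨m, hm⟩ : ∃ m, n - l = m + 1 := ⟨n - l - 1, by omega⟩
    obtain ⟨j, hj⟩ : ∃ j, k - l = j + 1 := ⟨k - l - 1, by omega⟩
    have e1 : n - (l + 1) = m := by omega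
    have e2 : k - (l + 1) = j := by omega
    rw [hm, hj] at ih
    rw [e1, e2]
    have h1 := Nat.add_one_mul_choose_eq m j
    have h2 : n * (j + 1) ≤ k * (m + 1) := by
      obtain ⟨d, rfl⟩ := Nat.exists_eq_add_of_le hkn
      have hk : k = j + 1 + l := by omega
      have hm' : m = j + d := by omega
      subst hk hm'
      nlinarith [Nat.zero_le (d * l)]
    have h3 : m.choose j * n ≤ k * (m + 1).choose (j + 1) := by
      have : (m.choose j * n) * (j + 1) ≤ (k * (m + 1).choose (j + 1)) * (j + 1) := by
        calc (m.choose j * n) * (j + 1) = m.choose j * (n * (j + 1)) := by ring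
          _ ≤ m.choose j * (k * (m + 1)) := Nat.mul_le_mul_left _ h2
          _ = k * ((m + 1) * m.choose j) := by ring
          _ = _ := by rw [h1]; ring
      exact Nat.le_of_mul_le_mul_right this (by omega)
    calc m.choose j * n ^ (l + 1) = (m.choose j * n) * n ^ l := by ring
      _ ≤ (k * (m + 1).choose (j + 1)) * n ^ l := Nat.mul_le_mul_right _ h3
      _ = k * ((m + 1).choose (j + 1) * n ^ l) := by ring
      _ ≤ k * (k ^ l * n.choose k) := Nat.mul_le_mul_left _ ih
      _ = _ := by ring

/-- The number of `k`-sets that contain a given `l`-set. -/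
theorem card_filter_superset {V : Type*} [Fintype V] [DecidableEq V] (L : Finset V) (k : ℕ)
    (hk : L.card ≤ k) :
    ((Finset.univ.powersetCard k).filter fun S : Finset V => L ⊆ S).card =
      (Fintype.card V - L.card).choose (k - L.card) := by
  rw [← Finset.card_compl, ← Finset.card_powersetCard]
  refine Finset.card_bij' (fun S _ => S \ L) (fun S _ => S ∪ L) ?_ ?_ ?_ ?_
  · intro S hS
    rw [Finset.mem_filter, Finset.mem_powersetCard] at hS
    rw [Finset.mem_powersetCard]
    refine ⟨fun x hx => by simpa using (Finset.mem_sdiff.1 hx).2, ?_⟩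
    rw [Finset.card_sdiff_of_subset hS.2, hS.1.2]
  · intro S hS
    rw [Finset.mem_powersetCard] at hS
    rw [Finset.mem_filter, Finset.mem_powersetCard]
    refine ⟨⟨Finset.subset_univ _, ?_⟩, Finset.subset_union_right⟩
    rw [Finset.card_union_of_disjoint, hS.2, Nat.sub_add_cancel hk]
    exact Finset.disjoint_left.2 fun x hx hL => Finset.mem_compl.1 (hS.1 hx) hL
  · intro S hS
    rw [Finset.mem_filter] at hS
    exact Finset.sdiff_union_of_subset hS.2
  · intro S hS
    rw [Finset.mem_powersetCard] at hS
    rw [Finset.union_sdiff_right]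
    exact Finset.sdiff_eq_self_of_disjoint
      (Finset.disjoint_left.2 fun x hx hL => Finset.mem_compl.1 (hS.1 hx) hL)

/-- The number of `k`-sets that meet a given `k`-set in `l` points. -/
theorem card_filter_inter_mul_pow_le {V : Type*} [Fintype V] [DecidableEq V] (S : Finset V)
    (l : ℕ) (hl : l ≤ S.card) :
    ((Finset.univ.powersetCard S.card).filter fun S' : Finset V => (S ∩ S').card = l).card *
        Fintype.card V ^ l ≤
      (S.card ^ 2) ^ l * (Fintype.card V).choose S.card := by
  -- Union bound over the common part `L`: its choice gives one factor `k ^ l`, and the requirement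
  -- `L ⊆ S'` gives the other together with `n ^ (-l)`.
  have hsub : ((Finset.univ.powersetCard S.card).filter
      fun S' : Finset V => (S ∩ S').card = l) ⊆ (S.powersetCard l).biUnion fun L =>
        (Finset.univ.powersetCard S.card).filter fun S' : Finset V => L ⊆ S' := by
    intro S' hS'
    rw [Finset.mem_filter] at hS'
    rw [Finset.mem_biUnion]
    exact ⟨S ∩ S', Finset.mem_powersetCard.2 ⟨Finset.inter_subset_left, hS'.2⟩,
      Finset.mem_filter.2 ⟨hS'.1, Finset.inter_subset_right⟩⟩
  have h1 := (Finset.card_le_card hsub).trans (Finset.card_biUnion_le_card_mul _ _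
    ((Fintype.card V - l).choose (S.card - l)) fun L hL => by
      have := (Finset.mem_powersetCard.1 hL).2
      rw [card_filter_superset L S.card (this ▸ hl), this])
  rw [Finset.card_powersetCard] at h1
  have h2 := choose_sub_mul_pow_le (Fintype.card V) S.card (Finset.card_le_univ S) l hl
  calc _ ≤ S.card.choose l * (Fintype.card V - l).choose (S.card - l) * Fintype.card V ^ l :=
        Nat.mul_le_mul_right _ h1
    _ = S.card.choose l * ((Fintype.card V - l).choose (S.card - l) * Fintype.card V ^ l) := by
        ring
    _ ≤ S.card ^ l * (S.card ^ l * (Fintype.card V).choose S.card) :=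
        Nat.mul_le_mul (Nat.choose_le_pow _ _) h2
    _ = _ := by ring

end Counting

/-! ### Janson for `k`-sets, and exponential rates -/

section Asymptotics

/-- If the correlation of any two dependence events overlapping in `l ≥ 2` vertices is controlled
by `M`, then it is very unlikely that no dependent `k`-set exists. -/
theorem prob_forall_notMem_degreesLE_le {V : Type*} [Fintype V] [DecidableEq V] {p : ℝ}
    (hp0 : 0 < p) (hp1 : p < 1) {k : ℕ} (hk : 2 ≤ k) (hkn : k ≤ Fintype.card V) (t : ℕ) {M : ℝ}
    (hM : 0 ≤ M)
    (h : ∀ S S' : Finset V, S.card = k → S'.card = k → 2 ≤ (S ∩ S').card →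
      ((k : ℝ) ^ 2) ^ (S ∩ S').card *
          prob (fun _ => p) (degreesLE t S S ∩ degreesLE t S' S') ≤
        (Fintype.card V : ℝ) ^ (S ∩ S').card * M * prob (fun _ => p) (degreesLE t S S) ^ 2) :
    prob (fun _ => p) {ω : Sym2 V → Bool | ∀ S : Finset V, S.card = k → ω ∉ degreesLE t S S} ≤
      Real.exp (-(1 / (2 * (k * M)))) := by
  set K : Finset (Finset V) := Finset.univ.powersetCard k with hK
  have hmemK : ∀ {S}, S ∈ K ↔ S.card = k := by simp [hK, Finset.mem_powersetCard]
  have hKcard : K.card = (Fintype.card V).choose k := by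
    rw [hK, Finset.card_powersetCard, Finset.card_univ]
  have hKpos : 0 < K.card := by rw [hKcard]; exact Nat.choose_pos hkn
  obtain ⟨S₀, hS₀⟩ := Finset.card_pos.1 hKpos
  set P := prob (fun _ => p) (degreesLE t S₀ S₀) with hP
  have hPeq : ∀ S ∈ K, prob (fun _ => p) (degreesLE t S S) = P := fun S hS =>
    prob_degreesLE_eq_of_card_eq p t ((hmemK.1 hS).trans (hmemK.1 hS₀).symm)
  have hPpos : 0 < P :=
    lt_of_lt_of_le (pow_pos (by linarith) _) (pow_le_prob_degreesLE hp0.le hp1.le t S₀)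
  have hμ : ∑ S : K, prob (fun _ => p) (degreesLE t S.1 S.1) = K.card * P := by
    rw [Finset.sum_coe_sort K fun S => prob (fun _ => p) (degreesLE t S S),
      Finset.sum_congr rfl hPeq, Finset.sum_const, nsmul_eq_mul]
  have hn : (0 : ℝ) < Fintype.card V := by
    have : 0 < Fintype.card V := by omega
    exact_mod_cast this
  have hk0 : (0 : ℝ) < (k : ℝ) ^ 2 := by
    have : (0 : ℝ) < k := by exact_mod_cast (by omega : 0 < k)
    positivity
  have hinner : ∀ S ∈ K, ∑ S' ∈ K, (if 2 ≤ (S ∩ S').card then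
      prob (fun _ => p) (degreesLE t S S ∩ degreesLE t S' S') else 0) ≤
        k * M * (K.card * P ^ 2) := by
    intro S hS
    have hSk := hmemK.1 hS
    have hle : ∀ S' : Finset V, (S ∩ S').card ≤ k := fun S' =>
      (Finset.card_le_card Finset.inter_subset_left).trans hSk.le
    -- The correlation excess allowed at overlap `l` is `x ^ l * M`. The number of sets with that
    -- overlap carries `x ^ (-l)`, so every overlap size contributes equally.
    set x : ℝ := Fintype.card V / (k : ℝ) ^ 2 with hx
    have hx0 : 0 < x := by positivity
    calc ∑ S' ∈ K, (if 2 ≤ (S ∩ S').card then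
          prob (fun _ => p) (degreesLE t S S ∩ degreesLE t S' S') else 0)
        ≤ ∑ S' ∈ K, ∑ l ∈ Finset.Icc 2 k, if (S ∩ S').card = l then x ^ l * (M * P ^ 2) else 0 := by
          refine Finset.sum_le_sum fun S' hS' => ?_
          rw [Finset.sum_ite_eq]
          by_cases h2 : 2 ≤ (S ∩ S').card
          · rw [if_pos h2, if_pos (Finset.mem_Icc.2 ⟨h2, hle S'⟩)]
            have h3 := h S S' hSk (hmemK.1 hS') h2
            rw [hPeq S hS] at h3
            rw [hx, div_pow, div_mul_eq_mul_div, le_div_iff₀ (by positivity)]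
            linarith
          · rw [if_neg h2, if_neg (by simp [h2])]
      _ = ∑ l ∈ Finset.Icc 2 k, ((K.filter fun S' => (S ∩ S').card = l).card : ℝ) *
            (x ^ l * (M * P ^ 2)) := by
          rw [Finset.sum_comm]
          refine Finset.sum_congr rfl fun l _ => ?_
          rw [← Finset.sum_filter, Finset.sum_const, nsmul_eq_mul]
      _ ≤ ∑ l ∈ Finset.Icc 2 k, K.card * (M * P ^ 2) := by
          refine Finset.sum_le_sum fun l hl => ?_
          rw [← mul_assoc]
          refine mul_le_mul_of_nonneg_right ?_ (by positivity)
          have h4 := card_filter_inter_mul_pow_le S l (by rw [hSk]; exact (Finset.mem_Icc.1 hl).2)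
          rw [hSk, ← hK, ← hKcard] at h4
          have h5 : ((K.filter fun S' => (S ∩ S').card = l).card : ℝ) * Fintype.card V ^ l ≤
              ((k : ℝ) ^ 2) ^ l * K.card := by exact_mod_cast h4
          rw [hx, div_pow, mul_div_assoc', div_le_iff₀ (by positivity)]
          linarith
      _ ≤ k * (K.card * (M * P ^ 2)) := by
          rw [Finset.sum_const, nsmul_eq_mul]
          refine mul_le_mul_of_nonneg_right ?_ (by positivity)
          rw [Nat.card_Icc]
          exact_mod_cast (by omega)
      _ = _ := by ring
  have hJ := janson (π := fun _ : Sym2 V => p) (fun _ => hp0.le) (fun _ => hp1.le)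
    (fun S : K => degreesLE t S.1 S.1) (fun S => (pairsWithin S.1 : Set (Sym2 V)))
    (fun S S' => 2 ≤ (S.1 ∩ S'.1).card) (fun S => isLowerSet_degreesLE t S.1 S.1)
    (fun S => supportedOn_degreesLE_self t S.1)
    (fun S S' hSS => disjoint_pairsWithin (by omega))
    (fun S S' hSS => by rwa [Finset.inter_comm])
    (fun S => by rw [Finset.inter_self, hmemK.1 S.2]; exact hk) (Q := k * M)
    (by rw [hμ]; exact mul_pos (by exact_mod_cast hKpos) hPpos)
    (by
      rw [hμ]
      have e : ∀ S : K, ∑ S' : K, (if 2 ≤ (S.1 ∩ S'.1).card then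
          prob (fun _ => p) (degreesLE t S.1 S.1 ∩ degreesLE t S'.1 S'.1) else 0) ≤
            k * M * (K.card * P ^ 2) := by
        intro S
        rw [Finset.sum_coe_sort K fun S' => if 2 ≤ (S.1 ∩ S').card then
          prob (fun _ => p) (degreesLE t S.1 S.1 ∩ degreesLE t S' S') else 0]
        exact hinner S.1 S.2
      refine (Finset.sum_le_card_nsmul _ _ _ fun S _ => e S).trans (le_of_eq ?_)
      rw [Finset.card_univ, Fintype.card_coe, nsmul_eq_mul]
      ring)
  refine le_trans (prob_mono (fun _ => hp0.le) (fun _ => hp1.le) fun ω hω => ?_) hJ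
  exact Set.mem_iInter.2 fun S => hω S.1 (hmemK.1 S.2)

/-- Gibbs' inequality: apply `ln z ≤ z - 1` to `p / x` and to `(1 - p) / (1 - x)`, and the linear
terms cancel. -/
theorem rateFn_nonneg {p x : ℝ} (hp0 : 0 < p) (hp1 : p < 1) (hx0 : 0 < x) (hx1 : x < 1) :
    0 ≤ rateFn p x := by
  have hq : 0 < 1 - p := by linarith
  have hx1' : 0 < 1 - x := by linarith
  have h1 := mul_le_mul_of_nonneg_left
    (Real.log_le_sub_one_of_pos (div_pos hp0 hx0)) hx0.le
  have h2 := mul_le_mul_of_nonneg_left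
    (Real.log_le_sub_one_of_pos (div_pos hq hx1')) hx1'.le
  have e1 : x * (p / x - 1) = p - x := by field_simp
  have e2 : (1 - x) * ((1 - p) / (1 - x) - 1) = x - p := by field_simp; ring
  rw [rateFn, ← inv_div p x, ← inv_div (1 - p) (1 - x), Real.log_inv, Real.log_inv]
  linarith

/-- The Chernoff bound of `prob_degreesLE_inter_le` has the right exponential rate. -/
theorem exists_chernoff_rate {p θ ξ : ℝ} (hp0 : 0 < p) (hp1 : p < 1) (hθ0 : 0 ≤ θ) (hθp : θ < p)
    (hξ : 0 < ξ) :
    ∃ β ψ : ℝ, 0 < β ∧ β ≤ 1 ∧ 1 - p + p * β ≤ ψ ∧ 1 - p + p * β ^ 2 ≤ ψ ^ 2 ∧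
      ∀ᶠ k : ℕ in atTop, ψ ^ (k - 1) / β ^ ⌊θ * k⌋₊ ≤
        Real.exp (-(k / 2 * (rateFn p θ - ξ))) := by
  have hq : 0 < 1 - p := by linarith
  -- Optimising the Chernoff exponent at `y > θ` rather than at `θ` keeps `ln (p / y)` meaningful
  -- when `θ = 0`.
  obtain ⟨y, hyθ, hyp, hrate⟩ : ∃ y, θ < y ∧ y < p ∧ rateFn p θ - ξ / 2 < rateFn p y := by
    have h1 : ∀ᶠ y in 𝓝[>] θ, rateFn p θ - ξ / 2 < rateFn p y :=
      ((continuous_rateFn hp0 hp1).continuousAt.eventually_const_lt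
        (by linarith)).filter_mono nhdsWithin_le_nhds
    have h2 : ∀ᶠ y in 𝓝[>] θ, y ∈ Set.Ioo θ p := Ioo_mem_nhdsGT hθp
    obtain ⟨y, hy1, hy2⟩ := (h1.and h2).exists
    exact ⟨y, hy2.1, hy2.2, hy1⟩
  have hy0 : 0 < y := by linarith
  have hy1 : 0 < 1 - y := by linarith
  set φ := (1 - p) / (1 - y) with hφ
  set s := Real.log (p / y) - Real.log φ with hs
  have hφ0 : 0 < φ := by positivity
  have hs0 : 0 ≤ s := by
    refine sub_nonneg.2 (Real.log_le_log hφ0 ?_)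
    rw [hφ, div_le_div_iff₀ hy1 hy0]
    nlinarith
  have hexp : Real.exp (-s) = φ * y / p := by
    rw [hs, neg_sub, Real.exp_sub, Real.exp_log hφ0, Real.exp_log (by positivity)]
    field_simp
  have hrate' : rateFn p y = -(s * y + Real.log φ) := by
    rw [rateFn, ← inv_div p y, ← inv_div (1 - p) (1 - y), Real.log_inv, Real.log_inv, hs, hφ]
    ring
  -- The weight `exp (-s)` is the one that tilts `p` to `y`. A pair counted twice should receive it,
  -- so each count receives its square root; for a pair counted once, `1 - p + p β ≤ √φ` is
  -- Cauchy-Schwarz, with defect `p (1 - p) (1 - β)²`.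
  set β := Real.exp (-s / 2) with hβ
  have hβ2 : β ^ 2 = Real.exp (-s) := by
    rw [hβ, ← Real.exp_nat_mul]; congr 1; push_cast; ring
  have hφeq : 1 - p + p * β ^ 2 = φ := by
    rw [hβ2, hexp, hφ]; field_simp; ring
  refine ⟨β, Real.sqrt φ, Real.exp_pos _, Real.exp_le_one_iff.2 (by linarith), ?_, ?_, ?_⟩
  · refine Real.le_sqrt_of_sq_le ?_
    rw [← hφeq]
    nlinarith [mul_nonneg (mul_nonneg hp0.le hq.le) (sq_nonneg (1 - β))]
  · rw [Real.sq_sqrt hφ0.le, hφeq]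
  · have h1 : ∀ᶠ k : ℕ in atTop, -Real.log φ ≤ (k : ℝ) * (ξ / 2) :=
      (tendsto_natCast_atTop_atTop.atTop_mul_const (by positivity)).eventually_ge_atTop _
    filter_upwards [h1, eventually_ge_atTop 1] with k hk hk1
    have e1 : Real.sqrt φ ^ (k - 1) = Real.exp ((k - 1) * (Real.log φ / 2)) := by
      rw [← Real.exp_log (Real.sqrt_pos.2 hφ0), Real.log_sqrt hφ0.le, ← Real.exp_nat_mul,
        Nat.cast_sub hk1, Nat.cast_one]
    have e2 : β ^ ⌊θ * k⌋₊ = Real.exp (⌊θ * k⌋₊ * (-s / 2)) := by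
      rw [hβ, ← Real.exp_nat_mul]
    rw [e1, e2, ← Real.exp_sub, Real.exp_le_exp]
    have hfl : (⌊θ * k⌋₊ : ℝ) ≤ θ * k := Nat.floor_le (by positivity)
    have h3 := mul_le_mul_of_nonneg_right hfl hs0
    have hk0 : (0 : ℝ) ≤ k := Nat.cast_nonneg k
    have h4 : θ * k * s ≤ y * k * s := by gcongr
    have h5 := mul_le_mul_of_nonneg_left hrate.le hk0
    rw [hrate'] at h5
    nlinarith

/-- The probability of dependence has the right exponential rate. -/
theorem eventually_le_prob_degreesLE {p θ ξ : ℝ} (hp0 : 0 < p) (hp1 : p < 1) (hθ0 : 0 ≤ θ)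
    (hθp : θ < p) (hξ : 0 < ξ) :
    ∀ᶠ k : ℕ in atTop, ∀ (n : ℕ) (S : Finset (Fin n)), S.card = k →
      Real.exp (-((k : ℝ) ^ 2 / 2 * (rateFn p θ + ξ))) ≤
        prob (fun _ => p) (degreesLE ⌊θ * k⌋₊ S S) := by
  have hq : 0 < 1 - p := by linarith
  have hchoose : ∀ k : ℕ, ((k.choose 2 : ℕ) : ℝ) ≤ (k : ℝ) ^ 2 / 2 := fun k => by
    rw [Nat.cast_choose_two]
    have : (0 : ℝ) ≤ k := Nat.cast_nonneg k
    nlinarith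
  -- At `θ = 0` there is no room for a tilt below `θ`, but the probability that `S` spans no edge
  -- already has the required rate.
  rcases hθ0.eq_or_lt with rfl | hθ
  · refine Eventually.of_forall fun k n S hS => ?_
    refine le_trans ?_ (pow_le_prob_degreesLE hp0.le hp1.le _ S)
    rw [hS, ← Real.exp_log hq, ← Real.exp_nat_mul, Real.exp_le_exp]
    have e : rateFn p 0 = -Real.log (1 - p) := by simp [rateFn]
    have h1 := rateFn_zero_pos hp0 hp1
    have h2 := mul_le_mul_of_nonneg_right (hchoose k) h1.le
    rw [e] at h1 h2 ⊢
    nlinarith [sq_nonneg (k : ℝ)]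
  · obtain ⟨y, hy0, hyθ, hrate⟩ : ∃ y, 0 < y ∧ y < θ ∧ rateFn p y < rateFn p θ + ξ / 4 := by
      have h1 : ∀ᶠ y in 𝓝[<] θ, rateFn p y < rateFn p θ + ξ / 4 :=
        ((continuous_rateFn hp0 hp1).continuousAt.eventually_lt_const
          (by linarith)).filter_mono nhdsWithin_le_nhds
      have h2 : ∀ᶠ y in 𝓝[<] θ, y ∈ Set.Ioo 0 θ := Ioo_mem_nhdsLT hθ
      obtain ⟨y, hy1, hy2⟩ := (h1.and h2).exists
      exact ⟨y, hy2.1, hy2.2, hy1⟩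
    have hy1 : 0 < 1 - y := by linarith
    set s := Real.log (p / y) - Real.log ((1 - p) / (1 - y)) with hs
    have hs0 : 0 ≤ s := by
      refine sub_nonneg.2 (Real.log_le_log (by positivity) ?_)
      rw [div_le_div_iff₀ hy1 hy0]
      nlinarith
    set η := ξ / (4 * (s + 1)) with hη
    have hη0 : 0 < η := by positivity
    have hηs : η * s ≤ ξ / 4 := by
      rw [hη, div_mul_eq_mul_div, div_le_div_iff₀ (by positivity) (by norm_num)]
      nlinarith
    set σ := θ - y with hσ
    have hσ0 : 0 < σ := by linarith
    have hσ1 : σ ≤ 1 := by linarith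
    set b := Real.exp σ with hb
    have hb1 : 1 ≤ b := Real.one_le_exp hσ0.le
    -- With `b ≤ 1 + σ + σ²` the left side is at most `1 + y σ + y σ²`, and the exponent on the
    -- right equals `y σ + y σ²`.
    have hmgf : 1 - y + y * b ≤ Real.exp (θ * σ - σ ^ 2 * (1 - y)) := by
      have h1 : b ≤ 1 + σ + σ ^ 2 := by
        have := Real.abs_exp_sub_one_sub_id_le (x := σ) (by rw [abs_of_pos hσ0]; exact hσ1)
        have := (abs_le.1 this).2
        linarith
      have h2 := Real.add_one_le_exp (θ * σ - σ ^ 2 * (1 - y))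
      have h3 : θ = y + σ := by rw [hσ]; ring
      rw [h3] at h2 ⊢
      nlinarith
    set d := σ ^ 2 * (1 - y) with hd
    have hd0 : 0 < d := by positivity
    have htail : Tendsto (fun k : ℕ => (k : ℝ) * Real.exp (-(d * k))) atTop (𝓝 0) := by
      have h1 := (Real.tendsto_pow_mul_exp_neg_atTop_nhds_zero 1).comp
        (tendsto_natCast_atTop_atTop.const_mul_atTop hd0 : Tendsto (fun k : ℕ => d * (k : ℝ)) _ _)
      have h2 := h1.const_mul d⁻¹
      rw [mul_zero] at h2
      refine h2.congr fun k => ?_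
      simp only [Function.comp, pow_one]
      field_simp
    -- Markov leaves only a constant probability `g` for having enough edges. This is sufficient,
    -- since a constant factor is absorbed by the slack in the exponent of order `k²`.
    set g := η / (1 - y + η) with hg
    have hg0 : 0 < g := by positivity
    have hgeq : (1 - y) / (1 - y + η) = 1 - g := by rw [hg]; field_simp; ring
    have hbig : ∀ᶠ k : ℕ in atTop, -Real.log (g / 2) ≤ (k : ℝ) * (ξ / 4) :=
      (tendsto_natCast_atTop_atTop.atTop_mul_const (by positivity)).eventually_ge_atTop _
    filter_upwards [htail.eventually_lt_const (half_pos hg0), hbig, eventually_ge_atTop 1]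
      with k hk1 hk2 hk3 n S hS
    refine le_trans ?_ (exp_mul_le_prob_degreesLE hp1 hy0 (by linarith) hη0 hb1 _ S)
    rw [hgeq, hS]
    have hkr : (1 : ℝ) ≤ k := by exact_mod_cast hk3
    have hmgf0 : (1 : ℝ) ≤ 1 - y + y * b := by nlinarith
    have hterm : (1 - y + y * b) ^ (k - 1) / b ^ (⌊θ * k⌋₊ + 1) ≤ Real.exp (-(d * k)) := by
      rw [div_le_iff₀ (by positivity)]
      calc (1 - y + y * b) ^ (k - 1) ≤ (1 - y + y * b) ^ k :=
            pow_le_pow_right₀ hmgf0 (Nat.sub_le _ _)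
        _ ≤ Real.exp (θ * σ - d) ^ k := pow_le_pow_left₀ (by linarith) hmgf k
        _ = Real.exp (-(d * k)) * Real.exp (θ * k * σ) := by
            rw [← Real.exp_nat_mul, ← Real.exp_add]; congr 1; ring
        _ ≤ Real.exp (-(d * k)) * b ^ (⌊θ * k⌋₊ + 1) := by
            refine mul_le_mul_of_nonneg_left ?_ (Real.exp_pos _).le
            rw [hb, ← Real.exp_nat_mul, Real.exp_le_exp]
            refine mul_le_mul_of_nonneg_right ?_ hσ0.le
            push_cast
            exact (Nat.lt_floor_add_one _).le
    have hfac : g / 2 ≤ 1 - (k : ℝ) * ((1 - y + y * b) ^ (k - 1) / b ^ (⌊θ * k⌋₊ + 1)) - (1 - g) := by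
      have := mul_le_mul_of_nonneg_left hterm (Nat.cast_nonneg k : (0 : ℝ) ≤ k)
      linarith
    refine le_trans ?_ (mul_le_mul_of_nonneg_left hfac (Real.exp_pos _).le)
    rw [← Real.exp_log (half_pos hg0), ← Real.exp_add, Real.exp_le_exp]
    have h6 : rateFn p y + η * s ≤ rateFn p θ + ξ / 2 := by linarith
    have hpos : 0 ≤ rateFn p y + η * s := by
      have := rateFn_nonneg hp0 hp1 hy0 (by linarith)
      positivity
    have h7 := mul_le_mul_of_nonneg_right (hchoose k) hpos
    have h8 := mul_le_mul_of_nonneg_left h6 (by positivity : (0 : ℝ) ≤ (k : ℝ) ^ 2 / 2)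
    have h9 : (k : ℝ) * (ξ / 4) ≤ (k : ℝ) ^ 2 * (ξ / 4) :=
      mul_le_mul_of_nonneg_right (by nlinarith) (by positivity)
    linarith

end Asymptotics

/-! ### Existence below the first-moment threshold -/

section Threshold

theorem tendsto_log_natCast_atTop : Tendsto (fun n : ℕ => Real.log n) atTop atTop :=
  Real.tendsto_log_atTop.comp tendsto_natCast_atTop_atTop

theorem tendsto_ceil_mul_log_div {κ : ℝ} (hκ : 0 < κ) :
    Tendsto (fun n : ℕ => (⌈κ * Real.log n⌉₊ : ℝ) / Real.log n) atTop (𝓝 κ) :=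
  (tendsto_nat_ceil_mul_div_atTop hκ.le).comp tendsto_log_natCast_atTop

theorem tendsto_ceil_mul_log_atTop {κ : ℝ} (hκ : 0 < κ) :
    Tendsto (fun n : ℕ => ⌈κ * Real.log n⌉₊) atTop atTop :=
  tendsto_nat_ceil_atTop.comp (tendsto_log_natCast_atTop.const_mul_atTop hκ)

theorem eventually_ceil_mul_log_mul_le {κ : ℝ} (hκ : 0 < κ) {x y : ℝ} (h : κ * x < y) :
    ∀ᶠ n : ℕ in atTop, (⌈κ * Real.log n⌉₊ : ℝ) * x ≤ y * Real.log n := by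
  filter_upwards [((tendsto_ceil_mul_log_div hκ).mul_const x).eventually_lt_const h,
    tendsto_log_natCast_atTop.eventually_gt_atTop 0] with n h1 h2
  rw [div_mul_eq_mul_div, div_lt_iff₀ h2] at h1
  exact h1.le

theorem eventually_ceil_mul_log_sq_le {κ a : ℝ} (hκ : 0 < κ) (ha : 0 < a) :
    ∀ᶠ n : ℕ in atTop, (⌈κ * Real.log n⌉₊ : ℝ) ^ 2 ≤ Real.exp (a * Real.log n) := by
  have h1 := ((Real.tendsto_pow_mul_exp_neg_atTop_nhds_zero 2).comp
    (tendsto_log_natCast_atTop.const_mul_atTop ha)).eventually_lt_const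
    (show (0 : ℝ) < (a / (2 * κ)) ^ 2 by positivity)
  filter_upwards [h1, eventually_ceil_mul_log_mul_le hκ (show κ * 1 < 2 * κ by linarith)]
    with n h1 h2
  simp only [Function.comp] at h1
  rw [Real.exp_neg, ← div_eq_mul_inv, div_lt_iff₀ (Real.exp_pos _)] at h1
  rw [mul_one] at h2
  have h3 := pow_le_pow_left₀ (Nat.cast_nonneg _) h2 2
  have e : (2 * κ * Real.log n) ^ 2 = (2 * κ / a) ^ 2 * (a * Real.log n) ^ 2 := by
    field_simp
  have e2 : (2 * κ / a) ^ 2 * ((a / (2 * κ)) ^ 2 * Real.exp (a * Real.log n)) =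
      Real.exp (a * Real.log n) := by field_simp
  have h4 := mul_le_mul_of_nonneg_left h1.le (sq_nonneg (2 * κ / a))
  rw [e2] at h4
  linarith

/-- Separates the one pair present at overlap `2` from the `l m` further pairs allowed when `l = m +
2`, so that `k⁴ / ((1 - p) n²)` can be factored out. -/
theorem choose_add_two_le (m : ℕ) : (m + 2).choose 2 ≤ 1 + (m + 2) * m := by
  induction m with
  | zero => simp
  | succ m ih =>
    rw [show m + 1 + 2 = (m + 2) + 1 by ring, Nat.choose_succ_succ' (m + 2) 1, Nat.choose_one_right]
    nlinarith

/-- Comparing exponents of `U ^ (k - l)` and `P`, the terms `k² Λ / 2` cancel to `k l Λ / 2`. The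
error is at most `k² ξ`, which `δ k ≤ l` turns into a multiple of `k l`. -/
theorem pow_sub_le_exp_mul {k l : ℕ} {Λ ξ δ γ ℓ U P : ℝ} (hlk : l ≤ k) (hδ : 0 < δ) (hξ : 0 < ξ)
    (hU0 : 0 ≤ U) (hU : U ≤ Real.exp (-(k / 2 * (Λ - ξ))))
    (hP : Real.exp (-((k : ℝ) ^ 2 / 2 * (Λ + ξ))) ≤ P)
    (hk : (k : ℝ) * (Λ / 2 + ξ / δ) ≤ (1 - γ) * ℓ) (hl : δ * k ≤ l) :
    U ^ (k - l) ≤ Real.exp (l * ((1 - γ) * ℓ)) * P := by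
  refine (pow_le_pow_left₀ hU0 hU (k - l)).trans
    (le_trans ?_ (mul_le_mul_of_nonneg_left hP (Real.exp_pos (l * ((1 - γ) * ℓ))).le))
  rw [← Real.exp_nat_mul, ← Real.exp_add, Real.exp_le_exp, Nat.cast_sub hlk]
  have h1 := mul_le_mul_of_nonneg_left hk (Nat.cast_nonneg l : (0 : ℝ) ≤ l)
  have h2 : (k : ℝ) * ξ ≤ l * (ξ / δ) := by
    have := mul_le_mul_of_nonneg_right hl (by positivity : 0 ≤ ξ / δ)
    have e : δ * k * (ξ / δ) = k * ξ := by field_simp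
    linarith
  have h3 := mul_le_mul_of_nonneg_left h2 (by positivity : (0 : ℝ) ≤ k)
  have h4 : 0 ≤ (k : ℝ) * l * ξ := by positivity
  have e : (l : ℝ) * (k * (Λ / 2 + ξ / δ)) = k * l * (Λ / 2) + k * (l * (ξ / δ)) := by ring
  rw [e] at h1
  linarith

/-- With `n = exp ℓ`: of the gain `n ^ (-γ l)`, half pays for `k ^ (2 l)`, and the other half is at
most `n ^ (-2)` because `γ l ≥ 4`. -/
theorem pow_mul_exp_le {k l : ℕ} {γ ℓ q : ℝ} (hq0 : 0 < q) (hq1 : q ≤ 1) (hk1 : (1 : ℝ) ≤ k)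
    (hℓ : 0 ≤ ℓ) (hk : (k : ℝ) ^ 2 ≤ Real.exp (γ / 2 * ℓ)) (hl : 4 ≤ γ * l) :
    ((k : ℝ) ^ 2) ^ l * Real.exp (l * ((1 - γ) * ℓ)) ≤
      Real.exp ℓ ^ l * ((k : ℝ) ^ 4 / (q * Real.exp ℓ ^ 2)) := by
  have h1 : ((k : ℝ) ^ 2) ^ l ≤ Real.exp (l * (γ / 2 * ℓ)) := by
    rw [Real.exp_nat_mul]
    exact pow_le_pow_left₀ (by positivity) hk l
  have h2 : Real.exp (-(2 * ℓ)) ≤ (k : ℝ) ^ 4 / (q * Real.exp ℓ ^ 2) := by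
    have e : Real.exp (-(2 * ℓ)) = 1 / Real.exp ℓ ^ 2 := by
      rw [← Real.exp_nat_mul, Real.exp_neg, one_div, Nat.cast_ofNat]
    have h12 : (1 : ℝ) ≤ (k : ℝ) ^ 4 := one_le_pow₀ hk1
    have h0 : 0 < Real.exp ℓ ^ 2 := by positivity
    rw [e, div_le_div_iff₀ h0 (by positivity), one_mul]
    exact mul_le_mul_of_nonneg_right (hq1.trans h12) h0.le
  refine le_trans ?_ (mul_le_mul_of_nonneg_left h2 (by positivity))
  refine (mul_le_mul_of_nonneg_right h1 (Real.exp_pos _).le).trans ?_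
  rw [← Real.exp_nat_mul, ← Real.exp_add, ← Real.exp_add, Real.exp_le_exp]
  have := mul_le_mul_of_nonneg_right hl hℓ
  linarith

/-- Below the first moment threshold, `⌊θ k⌋`-dependent sets of size `k = ⌈κ ln n⌉` exist with
probability extremely close to `1`. -/
theorem exists_prob_forall_notMem_degreesLE_le {p θ κ : ℝ} (hp0 : 0 < p) (hp1 : p < 1)
    (hθ0 : 0 ≤ θ) (hθp : θ < p) (hκ : 0 < κ) (hlt : κ / 2 * rateFn p θ < 1) :
    ∃ c : ℝ, 0 < c ∧ ∀ᶠ n : ℕ in atTop,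
      prob (fun _ => p) {ω : Sym2 (Fin n) → Bool | ∀ S : Finset (Fin n),
          S.card = ⌈κ * Real.log n⌉₊ →
            ω ∉ degreesLE ⌊θ * (⌈κ * Real.log n⌉₊ : ℝ)⌋₊ S S} ≤
        Real.exp (-(c * ((n : ℝ) ^ 2 / Real.log n ^ 5))) := by
  have hq : 0 < 1 - p := by linarith
  set Λ := rateFn p θ with hΛ
  set h := -Real.log (1 - p) with hh
  have hh0 : 0 < h := by rw [hh, neg_pos]; exact Real.log_neg hq (by linarith)
  have hqexp : 1 - p = Real.exp (-h) := by rw [hh, neg_neg, Real.exp_log hq]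
  -- Chosen so that `(1 - p) ^ (δ k)` is about `n ^ (-1/4)`, hence at least `n ^ (-1/2)` eventually.
  set δ := 1 / (4 * κ * h) with hδ
  have hδ0 : 0 < δ := by positivity
  -- The error `κ ξ / δ` then uses half of the gap `1 - κ Λ / 2`; `γ` below is half of what remains.
  set ξ := δ * (1 - κ / 2 * Λ) / (2 * κ) with hξ
  have hξ0 : 0 < ξ := by
    have : 0 < 1 - κ / 2 * Λ := by linarith
    positivity
  set lam := Λ / 2 + ξ / δ with hlam
  have hκlam : κ * lam < 1 := by
    have : κ * (ξ / δ) = (1 - κ / 2 * Λ) / 2 := by rw [hξ]; field_simp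
    rw [hlam, mul_add, this]
    linarith
  set γ := (1 - κ * lam) / 2 with hγ
  have hγ0 : 0 < γ := by rw [hγ]; linarith
  obtain ⟨β, ψ, hβ0, hβ1, hψ1, hψ2, hU⟩ := exists_chernoff_rate hp0 hp1 hθ0 hθp hξ0
  have hψ0 : 0 < ψ := by nlinarith [mul_pos hp0 hβ0]
  have hL := eventually_le_prob_degreesLE hp0 hp1 hθ0 hθp hξ0
  have hktop := tendsto_ceil_mul_log_atTop hκ
  -- From `1 / (2 k M) = (1 - p) n² / (2 k⁵)` and the crude bound `k ≤ 2 κ ln n`.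
  refine ⟨(1 - p) / (2 * (2 * κ) ^ 5), by positivity, ?_⟩
  filter_upwards [hktop.eventually hU, hktop.eventually hL, hktop.eventually (eventually_ge_atTop 2),
    (tendsto_natCast_atTop_atTop.comp hktop).eventually_ge_atTop (4 / (γ * δ)),
    eventually_ceil_mul_log_mul_le hκ (show κ * lam < 1 - γ by rw [hγ]; linarith),
    eventually_ceil_mul_log_mul_le hκ (show κ * (δ * h) < 1 / 2 by
      rw [hδ]; field_simp; norm_num),
    eventually_ceil_mul_log_mul_le hκ (show κ * 1 < 2 * κ by linarith),
    eventually_ceil_mul_log_sq_le hκ (show 0 < γ / 2 by positivity),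
    eventually_ceil_mul_log_sq_le hκ (show (0 : ℝ) < 1 / 2 by positivity),
    tendsto_log_natCast_atTop.eventually_gt_atTop 0, eventually_ge_atTop 1]
    with n hU hL hk2 hkbig hklam hkh hkκ hksq hksq' hlog hn1
  set k := ⌈κ * Real.log n⌉₊ with hk
  set ℓ := Real.log n with hℓ
  set t := ⌊θ * (k : ℝ)⌋₊ with ht
  simp only [Function.comp] at hkbig
  have hn0 : (0 : ℝ) < n := by exact_mod_cast hn1
  have hnexp : (n : ℝ) = Real.exp ℓ := by rw [hℓ, Real.exp_log hn0]
  have hk2r : (2 : ℝ) ≤ k := by exact_mod_cast hk2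
  have hkn : k ≤ n := by
    have h1 : (k : ℝ) ≤ n := by
      have h2 : (k : ℝ) ≤ (k : ℝ) ^ 2 := by nlinarith
      have h3 : Real.exp (1 / 2 * ℓ) ≤ Real.exp ℓ := Real.exp_le_exp.2 (by linarith)
      linarith
    exact_mod_cast h1
  set M := (k : ℝ) ^ 4 / ((1 - p) * (n : ℝ) ^ 2) with hM
  have hM0 : 0 < M := by positivity
  have hmain := prob_forall_notMem_degreesLE_le (V := Fin n) hp0 hp1 hk2
    (by rwa [Fintype.card_fin]) t hM0.le (by
    intro S S' hS hS' hl2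
    rw [Fintype.card_fin]
    set P := prob (fun _ => p) (degreesLE t S S) with hP
    have hPeq : prob (fun _ => p) (degreesLE t S' S') = P :=
      prob_degreesLE_eq_of_card_eq p t (hS'.trans hS.symm)
    have hP0 : 0 ≤ P := prob_nonneg (fun _ => hp0.le) (fun _ => hp1.le) _
    have hlk : (S ∩ S').card ≤ k := (Finset.card_le_card Finset.inter_subset_left).trans hS.le
    set l := (S ∩ S').card with hl
    rcases le_or_gt ((l : ℝ)) (δ * k) with hsmall | hlarge
    · have h1 := prob_degreesLE_inter_mul_pow_le hp0.le hp1.le t S S'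
      rw [hPeq, ← hP, ← hl] at h1
      obtain ⟨m, hm⟩ : ∃ m, l = m + 2 := ⟨l - 2, by omega⟩
      have h2 : (1 - p) * ((1 - p) ^ l) ^ m ≤ (1 - p) ^ l.choose 2 := by
        rw [← pow_mul, ← pow_succ']
        refine pow_le_pow_of_le_one hq.le (by linarith) ?_
        rw [hm]
        have := choose_add_two_le m
        linarith
      -- Both `k²` and `(1 - p) ^ (-l)` are at most `n ^ (1/2)`, so each of the `m` vertices of
      -- overlap beyond two costs nothing.
      have h3 : (k : ℝ) ^ 2 ≤ n * (1 - p) ^ l := by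
        rw [hqexp, ← Real.exp_nat_mul, hnexp, ← Real.exp_add]
        refine hksq'.trans (Real.exp_le_exp.2 ?_)
        have := mul_le_mul_of_nonneg_right hsmall hh0.le
        linarith
      set R := prob (fun _ => p) (degreesLE t S S ∩ degreesLE t S' S') with hR
      have hR0 : 0 ≤ R := prob_nonneg (fun _ => hp0.le) (fun _ => hp1.le) _
      have h4 : ((k : ℝ) ^ 2) ^ m ≤ (n : ℝ) ^ m * ((1 - p) ^ l) ^ m := by
        rw [← mul_pow]
        exact pow_le_pow_left₀ (by positivity) h3 m
      calc ((k : ℝ) ^ 2) ^ l * R = (k : ℝ) ^ 4 * (((k : ℝ) ^ 2) ^ m * R) := by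
            rw [hm]; ring
        _ ≤ (k : ℝ) ^ 4 * (((n : ℝ) ^ m * ((1 - p) ^ l) ^ m) * R) := by gcongr
        _ = (k : ℝ) ^ 4 * (n : ℝ) ^ m / (1 - p) * (R * ((1 - p) * ((1 - p) ^ l) ^ m)) := by
            field_simp
        _ ≤ (k : ℝ) ^ 4 * (n : ℝ) ^ m / (1 - p) * (P * P) := by
            refine mul_le_mul_of_nonneg_left ?_ (by positivity)
            exact (mul_le_mul_of_nonneg_left h2 hR0).trans h1
        _ = (n : ℝ) ^ l * M * P ^ 2 := by
            rw [hm, hM, pow_add]; field_simp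
    · have h1 := prob_degreesLE_inter_le hp0.le hp1.le hβ0 hβ1 hψ1 hψ2 t S S'
      have hsd : (S' \ S).card = k - l := by
        rw [Finset.card_sdiff, hS']
      rw [hS', hsd, ← hP] at h1
      have h2 : (ψ ^ (k - 1) / β ^ t) ^ (k - l) ≤ Real.exp ((l : ℝ) * ((1 - γ) * ℓ)) * P :=
        pow_sub_le_exp_mul hlk hδ0 hξ0 (by positivity) hU (hL n S hS) hklam hlarge.le
      have h9 : ((k : ℝ) ^ 2) ^ l * Real.exp ((l : ℝ) * ((1 - γ) * ℓ)) ≤ (n : ℝ) ^ l * M := by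
        rw [hM, hnexp]
        refine pow_mul_exp_le hq (by linarith) (by linarith) hlog.le hksq ?_
        rw [div_le_iff₀ (by positivity)] at hkbig
        have := mul_le_mul_of_nonneg_left hlarge.le hγ0.le
        linarith
      calc ((k : ℝ) ^ 2) ^ l * prob (fun _ => p) (degreesLE t S S ∩ degreesLE t S' S')
          ≤ ((k : ℝ) ^ 2) ^ l * (P * (Real.exp ((l : ℝ) * ((1 - γ) * ℓ)) * P)) := by
            refine mul_le_mul_of_nonneg_left (h1.trans ?_) (by positivity)
            exact mul_le_mul_of_nonneg_left h2 hP0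
        _ = ((k : ℝ) ^ 2) ^ l * Real.exp ((l : ℝ) * ((1 - γ) * ℓ)) * P ^ 2 := by ring
        _ ≤ (n : ℝ) ^ l * M * P ^ 2 := mul_le_mul_of_nonneg_right h9 (sq_nonneg _))
  refine hmain.trans (Real.exp_le_exp.2 (neg_le_neg ?_))
  have hk0 : (0 : ℝ) < k := by linarith
  have e : 1 / (2 * (k * M)) = (1 - p) * (n : ℝ) ^ 2 / (2 * (k : ℝ) ^ 5) := by
    rw [hM]; field_simp
  rw [e, div_mul_div_comm, mul_assoc, ← mul_pow]
  rw [mul_one] at hkκ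
  gcongr

end Threshold

/-! ### Passage to the binomial random graph -/

section Transfer

variable {V : Type*}

/-- The graph whose edges are the non-degenerate pairs marked `true`. -/
def graphOf (ω : Sym2 V → Bool) : SimpleGraph V :=
  SimpleGraph.fromEdgeSet {e | ω e = true}

theorem graphOf_eq_iff {ω : Sym2 V → Bool} {G : SimpleGraph V} :
    graphOf ω = G ↔ ∀ e, ¬ e.IsDiag → (ω e = true ↔ e ∈ G.edgeSet) := by
  rw [← SimpleGraph.edgeSet_inj, graphOf, SimpleGraph.edgeSet_fromEdgeSet, Set.ext_iff]
  refine forall_congr' fun e => ?_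
  by_cases he : e.IsDiag
  · have : e ∉ G.edgeSet := fun h => G.not_isDiag_of_mem_edgeSet h he
    simp [he, this]
  · simp [he]

variable [Fintype V]

theorem measurableSingletonClass_simpleGraph : MeasurableSingletonClass (SimpleGraph V) where
  measurableSet_singleton G := by
    have h : ({G} : Set (SimpleGraph V)) = SimpleGraph.edgeSet ⁻¹' {G.edgeSet} := by
      ext H
      simp
    rw [h]
    exact SimpleGraph.measurable_edgeSet (measurableSet_singleton _)

variable [DecidableEq V]

/-- The coordinates of the diagonal pairs are unconstrained and integrate out, so only the `C(|V|,
2)` genuine pairs contribute factors. -/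
theorem prob_graphOf_eq (p : ℝ) (G : SimpleGraph V) :
    prob (fun _ => p) {ω | graphOf ω = G} =
      p ^ G.edgeSet.ncard * (1 - p) ^ ((Fintype.card V).choose 2 - G.edgeSet.ncard) := by
  classical
  set A : Finset (Sym2 V) := pairsWithin Finset.univ with hA
  have hmemA : ∀ e : Sym2 V, e ∈ A ↔ ¬ e.IsDiag := by
    intro e
    induction e with
    | h u v => simp [hA, mk_mem_pairsWithin]
  have h := mean_prod_finset (π := fun _ : Sym2 V => p) A
    fun e b => if (b = true ↔ e ∈ G.edgeSet) then 1 else 0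
  have e1 : prob (fun _ => p) {ω | graphOf ω = G} = mean (fun _ => p)
      (fun ω : Sym2 V → Bool => ∏ e ∈ A, if (ω e = true ↔ e ∈ G.edgeSet) then 1 else 0) := by
    rw [prob]
    congr 1
    ext ω
    by_cases hω : graphOf ω = G
    · rw [Set.indicator_of_mem (show ω ∈ {ω | graphOf ω = G} from hω), Pi.one_apply,
        Finset.prod_eq_one]
      intro e he
      rw [if_pos (graphOf_eq_iff.1 hω e ((hmemA e).1 he))]
    · rw [Set.indicator_of_notMem (show ω ∉ {ω | graphOf ω = G} from hω)]
      rw [graphOf_eq_iff] at hω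
      push Not at hω
      obtain ⟨e, he, hne⟩ := hω
      refine (Finset.prod_eq_zero ((hmemA e).2 he) (if_neg ?_)).symm
      tauto
  have hsub : A.filter (fun e => e ∈ G.edgeSet) = G.edgeSet.toFinset := by
    ext e
    rw [Finset.mem_filter, hmemA, Set.mem_toFinset]
    exact ⟨fun h => h.2, fun h => ⟨G.not_isDiag_of_mem_edgeSet h, h⟩⟩
  have hcard : (A.filter fun e => e ∈ G.edgeSet).card = G.edgeSet.ncard := by
    rw [hsub, Set.ncard_eq_toFinset_card']
  have hcard' : (A.filter fun e => e ∉ G.edgeSet).card =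
      (Fintype.card V).choose 2 - G.edgeSet.ncard := by
    rw [← hcard, ← Finset.card_univ, ← card_pairsWithin, ← hA,
      ← Finset.card_filter_add_card_filter_not (s := A) (fun e => e ∈ G.edgeSet)]
    omega
  rw [e1, h, Finset.prod_congr rfl (g := fun e => if e ∈ G.edgeSet then p else 1 - p)
    fun e _ => by by_cases he : e ∈ G.edgeSet <;> simp [he],
    Finset.prod_ite, Finset.prod_const, Finset.prod_const, hcard, hcard']

theorem binomialRandom_real_eq_prob {p : ℝ} (hp0 : 0 ≤ p) (hp1 : p ≤ 1)
    (X : Set (SimpleGraph V)) :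
    (SimpleGraph.binomialRandom V ⟨p, hp0, hp1⟩).real X =
      prob (fun _ => p) {ω | graphOf ω ∈ X} := by
  classical
  have := measurableSingletonClass_simpleGraph (V := V)
  have h1 : (SimpleGraph.binomialRandom V ⟨p, hp0, hp1⟩).real X =
      ∑ G ∈ X.toFinset, (SimpleGraph.binomialRandom V ⟨p, hp0, hp1⟩).real {G} := by
    rw [sum_measureReal_singleton, Set.coe_toFinset]
  have h2 : prob (fun _ => p) {ω : Sym2 V → Bool | graphOf ω ∈ X} =
      ∑ G ∈ X.toFinset, prob (fun _ => p) {ω | graphOf ω = G} := by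
    simp only [prob]
    rw [← mean_sum]
    congr 1
    ext ω
    simp [Set.indicator_apply]
  rw [h1, h2]
  refine Finset.sum_congr rfl fun G _ => ?_
  rw [prob_graphOf_eq, measureReal_def, SimpleGraph.binomialRandom_singleton]
  simp [Nat.card_eq_fintype_card]

theorem card_le_dependenceNumber {ω : Sym2 V → Bool} {t t' : ℕ} (htt : t ≤ t') {S : Finset V}
    (h : ω ∈ degreesLE t S S) : S.card ≤ dependenceNumber (graphOf ω) t' := by
  classical
  refine Finset.le_sup (f := Finset.card) ?_
  rw [Finset.mem_filter]
  refine ⟨Finset.mem_univ _, ?_⟩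
  refine SimpleGraph.maxDegree_le_of_forall_degree_le _ _ fun v => ?_
  refine le_trans ?_ ((h v.1 v.2).trans htt)
  rw [← SimpleGraph.card_neighborFinset_eq_degree, degreeWithin,
    ← Finset.card_map (Function.Embedding.subtype _)]
  refine Finset.card_le_card fun u hu => ?_
  obtain ⟨w, hw, rfl⟩ := Finset.mem_map.1 hu
  rw [SimpleGraph.mem_neighborFinset, SimpleGraph.comap_adj] at hw
  have hw' : (graphOf ω).Adj v.1 w.1 := hw
  rw [graphOf, SimpleGraph.fromEdgeSet_adj] at hw'
  rw [Finset.mem_filter, Finset.mem_erase, Sym2.eq_swap]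
  exact ⟨⟨hw'.2.symm, w.2⟩, hw'.1⟩

end Transfer

theorem lemma9 (p : ℝ) (hp0 : 0 < p) (hp1 : p < 1) (τ ε : ℝ) (hτ : 0 ≤ τ) (hε : 0 < ε) :
    ∃ c : ℝ, 0 < c ∧ ∀ (t : ℕ → ℕ) (k : ℕ → ℝ),
      Tendsto (fun n : ℕ => (t n : ℝ) / Real.log n) atTop (𝓝 τ) →
      Tendsto (fun n : ℕ => k n / Real.log n) atTop (𝓝 (kappa p τ - ε)) →
      ∀ᶠ n : ℕ in atTop,
        (SimpleGraph.binomialRandom (Fin n) ⟨p, hp0.le, hp1.le⟩).real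
            {G : SimpleGraph (Fin n) | (dependenceNumber G (t n) : ℝ) < k n} ≤
          Real.exp (-(c * ((n : ℝ) ^ 2 / Real.log n ^ 5))) := by
  obtain ⟨hk1, -, hk2, -⟩ := kappa_spec hp0 hp1 hτ
  -- The maximum is needed because `kappa p τ - ε` may lie below `τ / p`, where the strict bound on
  -- the rate is not available.
  obtain ⟨κ, hκl, hκu⟩ := exists_between (max_lt hk1 (sub_lt_self (kappa p τ) hε))
  have hκτ : τ / p < κ := (le_max_left _ _).trans_lt hκl
  have hκε : kappa p τ - ε < κ := (le_max_right _ _).trans_lt hκl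
  have hκ0 : 0 < κ := (div_nonneg hτ hp0.le).trans_lt hκτ
  have hrate := hk2 κ hκτ hκu
  have hτκ : τ / κ < p := by
    rw [div_lt_iff₀ hp0] at hκτ
    rw [div_lt_iff₀ hκ0]
    linarith
  -- Continuity leaves room to take `θ` strictly below `τ / κ`, so that `⌊θ k⌋ ≤ t n` eventually,
  -- although `t n / ln n` may approach `τ` from below. For `τ = 0` the choice `θ = 0` makes the
  -- floor vanish. Both `κ` and `θ`, and hence `c`, are fixed before the sequences.
  obtain ⟨θ, hθ0, hθp, hθr, hθτ⟩ : ∃ θ, 0 ≤ θ ∧ θ < p ∧ κ / 2 * rateFn p θ < 1 ∧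
      (θ = 0 ∨ κ * θ < τ) := by
    rcases hτ.eq_or_lt with rfl | hτ0
    · exact ⟨0, le_rfl, hp0, by simpa using hrate, Or.inl rfl⟩
    · have h1 : ∀ᶠ y in 𝓝[<] (τ / κ), κ / 2 * rateFn p y < 1 :=
        (((continuous_rateFn hp0 hp1).const_mul (κ / 2)).continuousAt.eventually_lt_const
          hrate).filter_mono nhdsWithin_le_nhds
      have h2 : ∀ᶠ y in 𝓝[<] (τ / κ), y ∈ Set.Ioo 0 (τ / κ) :=
        Ioo_mem_nhdsLT (div_pos hτ0 hκ0)
      obtain ⟨y, hy1, hy2⟩ := (h1.and h2).exists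
      refine ⟨y, hy2.1.le, hy2.2.trans hτκ, hy1, Or.inr ?_⟩
      have := (lt_div_iff₀ hκ0).1 hy2.2
      linarith
  obtain ⟨c, hc0, hc⟩ := exists_prob_forall_notMem_degreesLE_le hp0 hp1 hθ0 hθp hκ0 hθr
  refine ⟨c, hc0, fun t k ht hk => ?_⟩
  have htev : ∀ᶠ n : ℕ in atTop, ⌊θ * (⌈κ * Real.log n⌉₊ : ℝ)⌋₊ ≤ t n := by
    rcases hθτ with rfl | hθτ
    · simp
    · obtain ⟨τ', h1, h2⟩ := exists_between hθτ
      filter_upwards [eventually_ceil_mul_log_mul_le hκ0 h1, ht.eventually_const_lt h2,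
        tendsto_log_natCast_atTop.eventually_gt_atTop 0] with n h3 h4 h5
      rw [lt_div_iff₀ h5] at h4
      exact Nat.floor_le_of_le (by linarith)
  filter_upwards [hc, htev, hk.eventually_lt_const hκε,
    tendsto_log_natCast_atTop.eventually_gt_atTop 0] with n hc htn hkn hlog
  rw [binomialRandom_real_eq_prob hp0.le hp1.le]
  refine (prob_mono (fun _ => hp0.le) (fun _ => hp1.le) fun ω hω S hS hmem => ?_).trans hc
  have h1 : (S.card : ℝ) ≤ dependenceNumber (graphOf ω) (t n) := by
    exact_mod_cast card_le_dependenceNumber htn hmem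
  rw [div_lt_iff₀ hlog] at hkn
  have h2 := Nat.le_ceil (κ * Real.log n)
  rw [hS] at h1
  have h3 : (dependenceNumber (graphOf ω) (t n) : ℝ) < k n := hω
  linarith
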